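/- Let $M$ be a complex manifold with complex structure $\mathcal J$ and a holomorphic symplectic form $\omega$, and let $c=\omega^{-1}$ be the inverse holomorphic Poisson bivector. Let $J$ be the real bihamiltonian structure on $M$ spanned by $c_1=\operatorname{Re}c$ and $c_2=\operatorname{Im}c$. Let $p:M\to M'$ be a smooth surjective submersion with connected fibres onto a real smooth manifold $M'$, and let $\mathcal K$ be the foliation of $M$ by the fibres of $p$. Assume that $\mathcal K$ is a generic $CR$-foliation: $\dim T_x^{1,0}\mathcal K$ is constant along each leaf and $T_x\mathcal K+\mathcal J\,T_x\mathcal K=T_xM$ for all $x$, where $T^{1,0}_xL=(T_xL\otimes\mathbb C)\cap T^{1,0}_xM$ for a submanifold $L$. A bihamiltonian structure on $M'$ is a two-dimensional real vector space of Poisson bivector fields, or the zero space. Let $J'$ be a bihamiltonian structure on $M'$ of which $(M,J,\mathcal K)$ is a realization: $c_1,c_2$ are projectable via $p$ and their push-forwards $c_1',c_2'$ span $J'$. Let $R_0$ be the maximum of the ranks $\operatorname{rank}a(y)$ over all $a\in J'$ and $y\in M'$. Say that $J'$ is complete at $x'\in M'$ if every nonzero element of its complexification $\{a+ib : a,b\in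 J'\}$ has rank $R_0$ at $x'$, and assume that $J'$ is complete, i.e. complete at all points of some open dense set. Let $U'\subset M'$ be the largest open set on which $J'$ is complete at every point. Let $\mathcal L'$ be the bilagrangian foliation of $J'$ on $U'$, that is, the foliation whose equations are the local first integrals of $J'$, the sums of local Casimir functions of members $a\in J'$ of maximal rank, $\max_{y}\operatorname{rank}a(y)=R_0$; so $T_{x'}\mathcal L'$ is the common kernel of the differentials at $x'$ of all first integrals defined near $x'$. Let $\mathcal L=p^{-1}(\mathcal L')$ be the foliation of $p^{-1}(U')$ with tangent spaces $T_x\mathcal L=(dp_x)^{-1}(T_{p(x)}\mathcal L')$. Then the realization is minimal, that is, $\mathcal K$ is $CR$-isotropic: $$T_x^{1,0}\mathcal K\subset (T_x^{1,0}\mathcal K)^{\perp\omega(x)}\quad\text{for all }x\in M,$$ if and only if $\mathcal L$ is $CR$-lagrangian: $$(T_x^{1,0}\mathcal L)^{\perp\omega(x)}=T_x^{1,0}\mathcal L\quad\text{for all }x\in p^{-1}(U').$$ Here $\perp\omega(x)$ is the skew-orthogonal complement in $T^{1,0}_xM$ with respect to $\omega(x)$. -/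

import Mathlib

open scoped Manifold ContDiff

noncomputable section

namespace CRBihamiltonian

/-! ### Real bivector fields and bihamiltonian structures

Throughout, the tangent space of a manifold at a point is the model vector space, as in Mathlib's
`TangentSpace`: it is read in the preferred chart at that point. -/

section Bihamiltonian

variable {F : Type*} [NormedAddCommGroup F] [NormedSpace ℝ F]
  {N : Type*} [TopologicalSpace N] [ChartedSpace F N]

/-- A field of contravariant two-tensors on `N`: at each point a bilinear form on the cotangent
space. It is a bivector field if all these forms are alternating. -/
abbrev TensorField (F : Type*) [NormedAddCommGroup F] [NormedSpace ℝ F] (N : Type*) :=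
  N → LinearMap.BilinForm ℝ (Module.Dual ℝ F)

/-- The differential of a real function at a point, as a continuous linear map. -/
def differentialL (f : N → ℝ) (x : N) : F →L[ℝ] ℝ := mfderiv 𝓘(ℝ, F) 𝓘(ℝ, ℝ) f x

/-- The differential of a real function at a point. -/
def differential (f : N → ℝ) (x : N) : Module.Dual ℝ F :=
  (differentialL f x).toLinearMap

/-- The bracket `{f, g} = c(df, dg)`. -/
def bracket (c : TensorField F N) (f g : N → ℝ) (x : N) : ℝ :=
  c x (differential f x) (differential g x)

/-- `f` is a smooth function on `U`. -/
def SmoothOn (F : Type*) [NormedAddCommGroup F] [NormedSpace ℝ F]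
    {N : Type*} [TopologicalSpace N] [ChartedSpace F N] (f : N → ℝ) (U : Set N) : Prop :=
  ContMDiffOn 𝓘(ℝ, F) 𝓘(ℝ, ℝ) ∞ f U

/-- `c` is a smooth Poisson bivector field: it is alternating, the bracket of smooth functions
is smooth, and the bracket satisfies the Jacobi identity. -/
structure IsPoisson (c : TensorField F N) : Prop where
  alternating : ∀ x, (c x).IsAlt
  smooth : ∀ (U : Set N), IsOpen U → ∀ f g : N → ℝ, SmoothOn F f U → SmoothOn F g U →
    SmoothOn F (bracket c f g) U
  jacobi : ∀ (U : Set N), IsOpen U → ∀ f g h : N → ℝ,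
    SmoothOn F f U → SmoothOn F g U → SmoothOn F h U → ∀ x ∈ U,
      bracket c f (bracket c g h) x + bracket c g (bracket c h f) x
        + bracket c h (bracket c f g) x = 0

/-- A bihamiltonian structure on `N`: a two-dimensional real vector space of Poisson bivector
fields, or the zero space (the trivial bihamiltonian structure). -/
structure IsBihamiltonian (J : Submodule ℝ (TensorField F N)) : Prop where
  poisson : ∀ c ∈ J, IsPoisson c
  dim : Module.finrank ℝ J = 2 ∨ J = ⊥

/-- The rank of a bilinear form (of a bivector): the dimension of the image of
the map `V → V^*`, `v ↦ B(v, ·)`. -/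
def formRank {K V : Type*} [Field K] [AddCommGroup V] [Module K V]
    (B : LinearMap.BilinForm K V) : ℕ :=
  Module.finrank K (LinearMap.range B)

/-- The rank of a bivector field: the maximum of its ranks at the points of `N`. -/
def fieldRank (c : TensorField F N) : ℕ := ⨆ x : N, formRank (c x)

/-- The number `R₀`: the maximal rank of a member of `J`. -/
def maxRank (J : Submodule ℝ (TensorField F N)) : ℕ := ⨆ c : J, fieldRank (c : TensorField F N)

/-- The value at `x` of the complex bivector field `a + i b`, as a complex bilinear form on the
complexified cotangent space `ℂ ⊗ T^*_x N`. -/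
def complexValue (a b : TensorField F N) (x : N) :
    LinearMap.BilinForm ℂ (TensorProduct ℝ ℂ (Module.Dual ℝ F)) :=
  (a x).baseChange ℂ + Complex.I • (b x).baseChange ℂ

/-- `J` is complete at `x`: all nonzero members `a + i b` (`a, b ∈ J`) of the complexification
of `J` have rank `R₀` at `x`. -/
def CompleteAt (J : Submodule ℝ (TensorField F N)) (x : N) : Prop :=
  ∀ a ∈ J, ∀ b ∈ J, (a ≠ 0 ∨ b ≠ 0) → formRank (complexValue a b x) = maxRank J

/-- `J` is complete: it is complete at every point of some open dense set.
(The trivial structure is complete.) -/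
def IsCompleteBihamiltonian (J : Submodule ℝ (TensorField F N)) : Prop :=
  ∃ U : Set N, IsOpen U ∧ Dense U ∧ ∀ x ∈ U, CompleteAt J x

/-- The largest open set on which `J` is complete at each point; the bilagrangian foliation
of `J` lives there. -/
def completeLocus (J : Submodule ℝ (TensorField F N)) : Set N :=
  interior {x | CompleteAt J x}

/-- `f` is a Casimir function of `c` over `U`: it is smooth on `U` and `c(f) = c(df, ·)`
vanishes on `U`. -/
def IsCasimirOn (c : TensorField F N) (U : Set N) (f : N → ℝ) : Prop :=
  SmoothOn F f U ∧ ∀ x ∈ U, c x (differential f x) = 0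

/-- The first integrals of `J` over `U`: the sum over all `c ∈ J` of maximal rank `R₀` of the
spaces of Casimir functions of `c` over `U`. -/
def firstIntegrals (J : Submodule ℝ (TensorField F N)) (U : Set N) : Submodule ℝ (N → ℝ) :=
  Submodule.span ℝ {f | ∃ c ∈ J, fieldRank c = maxRank J ∧ IsCasimirOn c U f}

/-- The tangent space at `x` of the foliation defined by the local first integrals of `J`
(for `x` in the complete locus: the tangent space of the bilagrangian foliation of `J`), that is,
the common kernel of the differentials at `x` of all first integrals on neighbourhoods of `x`. -/
def bilagrangianTangent (J : Submodule ℝ (TensorField F N)) (x : N) : Submodule ℝ F where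
  carrier := {v | ∀ U : Set N, IsOpen U → x ∈ U → ∀ f ∈ firstIntegrals J U, differential f x v = 0}
  add_mem' := by
    intro v w hv hw U hU hx f hf
    rw [map_add, hv U hU hx f hf, hw U hU hx f hf, add_zero]
  zero_mem' := by
    intro U hU hx f hf
    exact map_zero _
  smul_mem' := by
    intro r v hv U hU hx f hf
    rw [map_smul, hv U hU hx f hf, smul_zero]

end Bihamiltonian

/-! ### Holomorphic symplectic manifolds -/

section Symplectic

variable {E : Type*} [NormedAddCommGroup E] [NormedSpace ℂ E]

/-- The complex bilinear form `(v, w) ↦ η(v, w)` of an alternating two-form. -/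
def toBilin (η : E [⋀^Fin 2]→L[ℂ] ℂ) : LinearMap.BilinForm ℂ E :=
  LinearMap.mk₂ ℂ (fun v w => η ![v, w])
    (fun v v' w => η.toMultilinearMap.cons_add _ _ _)
    (fun a v w => η.toMultilinearMap.cons_smul _ _ _)
    (fun v w w' => by
      have h (u : E) : Function.update ![v, w] 1 u = ![v, u] := by
        ext i; fin_cases i <;> rfl
      simpa only [h] using η.map_update_add ![v, w] 1 w w')
    (fun a v w => by
      have h (u : E) : Function.update ![v, w] 1 u = ![v, u] := by
        ext i; fin_cases i <;> rfl
      simpa only [h] using η.map_update_smul ![v, w] 1 a w)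

/-- The complex differential at `y` of the inverse of a chart. -/
def chartInverseDifferential {M : Type*} [TopologicalSpace M] [ChartedSpace E M]
    (e : OpenPartialHomeomorph M E) (y : E) : E →L[ℂ] E :=
  mfderiv 𝓘(ℂ, E) 𝓘(ℂ, E) e.symm y

/-- The expression of a two-form on `M` in the chart `e`: its pull-back by the inverse of `e`. -/
def formInChart {M : Type*} [TopologicalSpace M] [ChartedSpace E M]
    (η : M → E [⋀^Fin 2]→L[ℂ] ℂ) (e : OpenPartialHomeomorph M E) (y : E) : E [⋀^Fin 2]→L[ℂ] ℂ :=
  (η (e.symm y)).compContinuousLinearMap (chartInverseDifferential e y)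

/-- A holomorphic symplectic form on a complex manifold `M` modelled on `E`: a nondegenerate
`(2,0)`-form that is holomorphic and closed in the charts of `M`.

The holomorphic tangent space `T^{1,0}_x M` is identified with the real tangent space with its
complex structure (so with `E`) by `v ↦ (v - i 𝒥 v)/2`; a `(2,0)`-form is thereby a complex
bilinear alternating form on `E`, and equals the restriction of the form to real vectors. -/
structure HolomorphicSymplecticForm (E : Type*) [NormedAddCommGroup E] [NormedSpace ℂ E]
    (M : Type*) [TopologicalSpace M] [ChartedSpace E M] where
  toFun : M → E [⋀^Fin 2]→L[ℂ] ℂ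
  holomorphic : ∀ e ∈ atlas E M, DifferentiableOn ℂ (formInChart toFun e) e.target
  closed : ∀ e ∈ atlas E M, ∀ y ∈ e.target, extDeriv (formInChart toFun e) y = 0
  nondegenerate : ∀ x, (toBilin (toFun x)).Nondegenerate

/-- The `(1,0)`-part `v ↦ (α(v) - i α(i v))/2` of a real covector `α`, that is, the value of the
complex linear extension of `α` on the vector `(v - i 𝒥 v)/2` of type `(1,0)`. -/
def covectorOneZero (α : Module.Dual ℝ E) : Module.Dual ℂ E :=
  (1 / 2 : ℂ) • α.extendRCLikeₗ (𝕜 := ℂ)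

lemma covectorOneZero_add (α β : Module.Dual ℝ E) :
    covectorOneZero (α + β) = covectorOneZero α + covectorOneZero β := by
  simp [covectorOneZero]

lemma covectorOneZero_smul (r : ℝ) (α : Module.Dual ℝ E) :
    covectorOneZero (r • α) = (r : ℂ) • covectorOneZero α := by
  ext v
  simp [covectorOneZero, Module.Dual.extendRCLikeₗ_apply, Module.Dual.extendRCLike_apply]
  ring

variable [FiniteDimensional ℂ E] {M : Type*} [TopologicalSpace M] [ChartedSpace E M]

/-- For a complex covector `ξ` of type `(1,0)`, the vector `v` with `Ω(v, ·) = ξ`. -/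
def sharp (Ω : HolomorphicSymplecticForm E M) (x : M) : Module.Dual ℂ E ≃ₗ[ℂ] E :=
  ((toBilin (Ω.toFun x)).toDual (Ω.nondegenerate x)).symm

/-- The value on real covectors of the holomorphic bivector field `c = Ω⁻¹`: the form `Ω`
transported to covectors by the isomorphism of the tangent and cotangent spaces given by `Ω`. -/
def inverseBivector (Ω : HolomorphicSymplecticForm E M) (x : M) (α β : Module.Dual ℝ E) : ℂ :=
  toBilin (Ω.toFun x) (sharp Ω x (covectorOneZero α)) (sharp Ω x (covectorOneZero β))

lemma inverseBivector_smul_left (Ω : HolomorphicSymplecticForm E M) (x : M) (r : ℝ)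
    (α β : Module.Dual ℝ E) :
    inverseBivector Ω x (r • α) β = (r : ℂ) * inverseBivector Ω x α β := by
  unfold inverseBivector
  rw [covectorOneZero_smul, LinearEquiv.map_smul, LinearMap.map_smul, LinearMap.smul_apply,
    smul_eq_mul]

lemma inverseBivector_smul_right (Ω : HolomorphicSymplecticForm E M) (x : M) (r : ℝ)
    (α β : Module.Dual ℝ E) :
    inverseBivector Ω x α (r • β) = (r : ℂ) * inverseBivector Ω x α β := by
  unfold inverseBivector
  rw [covectorOneZero_smul, LinearEquiv.map_smul, LinearMap.map_smul, smul_eq_mul]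

/-- The real bivector field `Re c`, where `c = Ω⁻¹`. -/
def reBivector (Ω : HolomorphicSymplecticForm E M) : TensorField E M := fun x =>
  LinearMap.mk₂ ℝ (fun α β => (inverseBivector Ω x α β).re)
    (by intro α α' β; simp [inverseBivector, covectorOneZero_add])
    (by intro r α β; simp [inverseBivector_smul_left])
    (by intro α β β'; simp [inverseBivector, covectorOneZero_add])
    (by intro r α β; simp [inverseBivector_smul_right])

/-- The real bivector field `Im c`, where `c = Ω⁻¹`. -/
def imBivector (Ω : HolomorphicSymplecticForm E M) : TensorField E M := fun x =>
  LinearMap.mk₂ ℝ (fun α β => (inverseBivector Ω x α β).im)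
    (by intro α α' β; simp [inverseBivector, covectorOneZero_add])
    (by intro r α β; simp [inverseBivector_smul_left])
    (by intro α β β'; simp [inverseBivector, covectorOneZero_add])
    (by intro r α β; simp [inverseBivector_smul_right])

end Symplectic

/-! ### Foliations and CR-geometry -/

section CR

variable {E : Type*} [NormedAddCommGroup E] [NormedSpace ℂ E]

/-- Multiplication by `i` on the tangent spaces of a complex manifold. -/
def complexStructure (E : Type*) [NormedAddCommGroup E] [NormedSpace ℂ E] : E →ₗ[ℝ] E :=
  (Complex.I • (LinearMap.id : E →ₗ[ℂ] E)).restrictScalars ℝ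

/-- For a real subspace `D` of a complex vector space, the complex subspace `D ∩ i D`. For
`D = T_x L` this is `T^{CR}_x L`, identified with `T^{1,0}_x L` by `v ↦ (v - i 𝒥 v)/2`. -/
def crSubspace (D : Submodule ℝ E) : Submodule ℂ E where
  carrier := {v | v ∈ D ∧ v ∈ D.map (complexStructure E)}
  add_mem' := fun hv hw => ⟨D.add_mem hv.1 hw.1, Submodule.add_mem _ hv.2 hw.2⟩
  zero_mem' := ⟨D.zero_mem, Submodule.zero_mem _⟩
  smul_mem' := by
    rintro a v ⟨h1, w, hw, rfl⟩
    have hI : Complex.I • complexStructure E w = -w := by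
      simp [complexStructure, smul_smul]
    have ha : a • complexStructure E w = a.re • complexStructure E w - a.im • w := by
      conv_lhs => rw [← Complex.re_add_im a]
      rw [add_smul, mul_smul, hI, smul_neg, Complex.coe_smul, Complex.coe_smul, sub_eq_add_neg]
    have hb : a • complexStructure E w = complexStructure E (a.re • w +
        a.im • complexStructure E w) := by
      rw [ha, map_add, map_smul, map_smul]
      have : complexStructure E (complexStructure E w) = -w := hI
      rw [this, smul_neg, sub_eq_add_neg]
    refine ⟨?_, ?_⟩
    · rw [ha]
      exact D.sub_mem (D.smul_mem _ h1) (D.smul_mem _ hw)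
    · rw [hb]
      exact Submodule.mem_map_of_mem (D.add_mem (D.smul_mem _ hw) (D.smul_mem _ h1))

variable {M : Type*} [TopologicalSpace M] [ChartedSpace E M]

/-- The foliation of an open set `U` with tangent spaces `D x` is `CR`-isotropic:
`T^{1,0}` is contained in its skew-orthogonal complement with respect to `Ω`. -/
def IsCRIsotropicOn (Ω : HolomorphicSymplecticForm E M) (U : Set M) (D : M → Submodule ℝ E) :
    Prop :=
  ∀ x ∈ U, crSubspace (D x) ≤ (toBilin (Ω.toFun x)).orthogonal (crSubspace (D x))

/-- The foliation of an open set `U` with tangent spaces `D x` is `CR`-lagrangian: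
`T^{1,0}` is equal to its skew-orthogonal complement with respect to `Ω`.
(In particular the dimension of `T^{1,0}` is half of that of `M`, hence constant.) -/
def IsCRLagrangianOn (Ω : HolomorphicSymplecticForm E M) (U : Set M) (D : M → Submodule ℝ E) :
    Prop :=
  ∀ x ∈ U, (toBilin (Ω.toFun x)).orthogonal (crSubspace (D x)) = crSubspace (D x)

variable {E' : Type*} [NormedAddCommGroup E'] [NormedSpace ℝ E']
  {M' : Type*} [TopologicalSpace M'] [ChartedSpace E' M']

/-- The real differential of a map from a complex manifold to a real manifold, as a continuous
linear map. -/
def realDifferentialL (E E' : Type*) [NormedAddCommGroup E] [NormedSpace ℂ E]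
    [NormedAddCommGroup E'] [NormedSpace ℝ E']
    {M : Type*} [TopologicalSpace M] [ChartedSpace E M]
    {M' : Type*} [TopologicalSpace M'] [ChartedSpace E' M'] (p : M → M') (x : M) : E →L[ℝ] E' :=
  mfderiv 𝓘(ℝ, E) 𝓘(ℝ, E') p x

/-- The real differential of a map from a complex manifold to a real manifold. -/
def realDifferential (E E' : Type*) [NormedAddCommGroup E] [NormedSpace ℂ E]
    [NormedAddCommGroup E'] [NormedSpace ℝ E']
    {M : Type*} [TopologicalSpace M] [ChartedSpace E M]
    {M' : Type*} [TopologicalSpace M'] [ChartedSpace E' M'] (p : M → M') (x : M) : E →ₗ[ℝ] E' :=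
  (realDifferentialL E E' p x).toLinearMap

/-- `p : M → M'` is a smooth surjective submersion with connected fibres
(`IsConnected` includes non-emptiness). -/
structure IsFibration (E E' : Type*) [NormedAddCommGroup E] [NormedSpace ℂ E]
    [NormedAddCommGroup E'] [NormedSpace ℝ E']
    {M : Type*} [TopologicalSpace M] [ChartedSpace E M]
    {M' : Type*} [TopologicalSpace M'] [ChartedSpace E' M'] (p : M → M') : Prop where
  smooth : ContMDiff 𝓘(ℝ, E) 𝓘(ℝ, E') ∞ p
  submersion : ∀ x, Function.Surjective (realDifferential E E' p x)
  connected : ∀ x' : M', IsConnected (p ⁻¹' {x'})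

/-- The tangent spaces of the foliation `𝒦` of `M` by the fibres of `p`. -/
def fibreTangent (E E' : Type*) [NormedAddCommGroup E] [NormedSpace ℂ E]
    [NormedAddCommGroup E'] [NormedSpace ℝ E']
    {M : Type*} [TopologicalSpace M] [ChartedSpace E M]
    {M' : Type*} [TopologicalSpace M'] [ChartedSpace E' M'] (p : M → M') (x : M) :
    Submodule ℝ E :=
  LinearMap.ker (realDifferential E E' p x)

/-- The foliation `𝒦` by the fibres of `p` is a generic `CR`-foliation: along each fibre
the dimension of `T^{1,0}𝒦` is constant, and `T𝒦 + 𝒥 T𝒦 = TM`. -/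
structure IsGenericCRFibration (E E' : Type*) [NormedAddCommGroup E] [NormedSpace ℂ E]
    [NormedAddCommGroup E'] [NormedSpace ℝ E']
    {M : Type*} [TopologicalSpace M] [ChartedSpace E M]
    {M' : Type*} [TopologicalSpace M'] [ChartedSpace E' M'] (p : M → M') : Prop where
  constant_dim : ∀ x' : M', ∃ d : ℕ, ∀ x ∈ p ⁻¹' {x'},
    Module.finrank ℂ (crSubspace (fibreTangent E E' p x)) = d
  generic : ∀ x, fibreTangent E E' p x ⊔ (fibreTangent E E' p x).map (complexStructure E) = ⊤

/-- The tangent spaces of the pull-back `p⁻¹(𝓛')` of the foliation `𝓛'` of (an open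
subset of) `M'` with tangent spaces `D'`. -/
def pullbackTangent (p : M → M') (D' : M' → Submodule ℝ E') (x : M) : Submodule ℝ E :=
  (D' (p x)).comap (realDifferential E E' p x)

/-- `c` is projectable via `p` with push-forward `c'`: the image of `c` at `x` under the
differential of `p` is `c'` at `p x`, for all `x`. -/
def IsPushforward (p : M → M') (c : TensorField E M) (c' : TensorField E' M') : Prop :=
  ∀ (x : M) (α β : Module.Dual ℝ E'),
    c' (p x) α β = c x (α ∘ₗ realDifferential E E' p x) (β ∘ₗ realDifferential E E' p x)

variable [FiniteDimensional ℂ E]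

/-- The holomorphic symplectic bihamiltonian structure `J`, spanned by `Re c` and `Im c`
with `c = Ω⁻¹`, is, together with the foliation by the fibres of `p`, a realization
of `J'`: `p` is a surjective submersion with connected fibres, `Re c` and `Im c` are
projectable, and `J'` is spanned by their push-forwards. -/
structure IsRealization (Ω : HolomorphicSymplecticForm E M) (p : M → M')
    (J' : Submodule ℝ (TensorField E' M')) : Prop where
  fibration : IsFibration E E' p
  pushforward : ∃ c₁' c₂' : TensorField E' M',
    IsPushforward p (reBivector Ω) c₁' ∧ IsPushforward p (imBivector Ω) c₂' ∧
      J' = Submodule.span ℝ {c₁', c₂'}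

/-- The realization is minimal: the foliation `𝒦` by the fibres of `p` is `CR`-isotropic. -/
def IsMinimal (E' : Type*) [NormedAddCommGroup E'] [NormedSpace ℝ E']
    {M' : Type*} [TopologicalSpace M'] [ChartedSpace E' M']
    (Ω : HolomorphicSymplecticForm E M) (p : M → M') : Prop :=
  IsCRIsotropicOn Ω Set.univ (fibreTangent E E' p)

end CR

end CRBihamiltonian

end

open CRBihamiltonian

/-!
Fix `x ∈ M`. The differential of `p` and the symplectic form turn complex covectors on `M'` at `p x`
into holomorphic tangent vectors at `x`; let `R` be the image. The pull-back of `Ω` to covectors is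
`c₁ + i c₂`, and `R` is the skew-orthogonal complement of `T^{1,0}𝒦`. Hence `𝒦` is `CR`-isotropic at
`x` if and only if `R` is coisotropic. As `𝒦` is generic, the covectors are mapped injectively to
`R`, and coisotropy becomes the bound `rank (c₁ + i c₂) ≤ 2 dim M' - dim_ℂ M` at `p x`.

At a point of completeness all nonzero members of the complexified pencil have the same rank, and
then the span `Φ` of their kernels is its own orthogonal with respect to each of them. Now `Φ` is
already spanned by the kernels of the real members, and by Frobenius' theorem these consist of
differentials of local Casimir functions, so `Φ` is the complexified annihilator of `T𝓛'`. The
complement of `T^{1,0}𝓛` is the image of `Φ` in `R`, and if `R` is coisotropic this image is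
lagrangian, since `Φ` is lagrangian for `c₁ + i c₂`.

Conversely, `T𝒦 ⊆ T𝓛`, so `𝒦` is `CR`-isotropic over the complete locus when `𝓛` is
`CR`-lagrangian; the complete locus is dense and the rank is lower semicontinuous, so the rank bound
extends to all of `M'`.

For Frobenius' theorem, the flows of a commuting frame are obtained from the implicit function
theorem in the space of continuous paths, which yields their smooth dependence on initial values.
-/

noncomputable section

namespace CRBihamiltonian

/-! ### Frobenius' theorem -/

section ImplicitFunction

open Filter Topology

variable {𝕜 E₁ E₂ F : Type*} [RCLike 𝕜] [NormedAddCommGroup E₁] [NormedSpace 𝕜 E₁]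
  [NormedAddCommGroup E₂] [NormedSpace 𝕜 E₂]
  [NormedAddCommGroup F] [NormedSpace 𝕜 F] {n : WithTop ℕ∞}

lemma fderiv_eq_of_eventually_apply_eq {f : E₁ × E₂ → F} {ψ : E₁ → E₂} {x : E₁} {c : F}
    (hf : DifferentiableAt 𝕜 f (x, ψ x)) (hψ : DifferentiableAt 𝕜 ψ x)
    (hc : ∀ᶠ y in 𝓝 x, f (y, ψ y) = c)
    (hinj : Function.Injective (fderiv 𝕜 f (x, ψ x) ∘L .inr 𝕜 E₁ E₂)) {v : E₁} {w : E₂}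
    (hvw : fderiv 𝕜 f (x, ψ x) (v, w) = 0) : fderiv 𝕜 ψ x v = w := by
  have hcomp := hf.hasFDerivAt.comp x ((hasFDerivAt_id x).prodMk hψ.hasFDerivAt)
  have hzero : fderiv 𝕜 f (x, ψ x) (v, fderiv 𝕜 ψ x v) = 0 :=
    DFunLike.congr_fun (hcomp.unique ((hasFDerivAt_const c x).congr_of_eventuallyEq hc)) v
  refine hinj (sub_eq_zero.1 ?_)
  rw [← map_sub, ContinuousLinearMap.comp_apply, ContinuousLinearMap.inr_apply,
    show ((0 : E₁), fderiv 𝕜 ψ x v - w) = (v, fderiv 𝕜 ψ x v) - (v, w) by simp, map_sub, hzero,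
    hvw, sub_zero]

variable [CompleteSpace E₂]

lemma eventually_isInvertible_fderiv_comp_inr {f : E₁ × E₂ → F} {u : E₁ × E₂}
    (hf : ContDiff 𝕜 n f) (hn : n ≠ 0)
    (hu : (fderiv 𝕜 f u ∘L .inr 𝕜 E₁ E₂).IsInvertible) :
    ∀ᶠ v in 𝓝 u, (fderiv 𝕜 f v ∘L .inr 𝕜 E₁ E₂).IsInvertible := by
  have hcont : Continuous fun v => fderiv 𝕜 f v ∘L .inr 𝕜 E₁ E₂ :=
    (hf.continuous_fderiv hn).clm_comp continuous_const
  obtain ⟨e, he⟩ := hu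
  exact hcont.continuousAt.preimage_mem_nhds (he ▸ ContinuousLinearEquiv.nhds e)

lemma eventually_contDiffAt_implicitFunction [CompleteSpace E₁] [CompleteSpace F]
    {f : E₁ × E₂ → F} {u : E₁ × E₂}
    (hf : ContDiff 𝕜 n f) (hn : n ≠ 0)
    (hu : (fderiv 𝕜 f u ∘L .inr 𝕜 E₁ E₂).IsInvertible) :
    ∀ᶠ x in 𝓝 u.1, ContDiffAt 𝕜 n (hf.contDiffAt.implicitFunction hn hu) x := by
  set ψ := hf.contDiffAt.implicitFunction hn hu
  have hψu : (u.1, ψ u.1) = u :=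
    Prod.ext rfl (hf.contDiffAt.implicitFunction_apply_self hn hu)
  have hgraph : Tendsto (fun x => (x, ψ x)) (𝓝 u.1) (𝓝 u) := by
    have := (continuousAt_id (x := u.1)).prodMk
      (hf.contDiffAt.contDiffAt_implicitFunction hn hu).continuousAt
    rwa [ContinuousAt, id, hψu] at this
  filter_upwards [hf.contDiffAt.eventually_apply_implicitFunction hn hu,
    hgraph.eventually (eventually_isInvertible_fderiv_comp_inr hf hn hu),
    hgraph.eventually
      (hf.contDiffAt.eventually_apply_eq_iff_implicitFunction hn hu).eventually_nhds]
    with x hfx hx hunique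
  refine (hf.contDiffAt.contDiffAt_implicitFunction hn hx).congr_of_eventuallyEq ?_
  have hφ := (continuousAt_id (x := x)).prodMk
    (hf.contDiffAt.contDiffAt_implicitFunction hn hx).continuousAt
  rw [ContinuousAt, id, hf.contDiffAt.implicitFunction_apply_self hn hx] at hφ
  filter_upwards [hφ.eventually hunique, hf.contDiffAt.eventually_apply_implicitFunction hn hx]
    with y hy hfy
  exact hy.1 (hfy.trans hfx)

end ImplicitFunction

section Paths

universe u

variable {K : Type*} [TopologicalSpace K] [CompactSpace K]

/-- The evaluation of operators on vectors, applied pointwise to continuous maps on a compact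
space. -/
def pointwiseApply (K : Type*) [TopologicalSpace K] [CompactSpace K] (E F : Type*)
    [NormedAddCommGroup E] [NormedSpace ℝ E] [NormedAddCommGroup F] [NormedSpace ℝ F] :
    C(K, E →L[ℝ] F) →L[ℝ] C(K, E) →L[ℝ] C(K, F) :=
  LinearMap.mkContinuous₂
    (LinearMap.mk₂ ℝ (fun (A : C(K, E →L[ℝ] F)) (γ : C(K, E)) => ⟨fun t => A t (γ t), by fun_prop⟩)
      (fun _ _ _ => rfl) (fun _ _ _ => rfl)
      (fun A _ _ => ContinuousMap.ext fun t => map_add (A t) _ _)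
      (fun r A _ => ContinuousMap.ext fun t => map_smul (A t) r _)) 1 (by
      intro A γ
      rw [one_mul]
      refine (ContinuousMap.norm_le _ (by positivity)).2 fun t => ?_
      exact (A t).le_of_opNorm_le_of_le (A.norm_coe_le_norm t) (γ.norm_coe_le_norm t))

@[simp]
lemma pointwiseApply_apply {E F : Type*}
    [NormedAddCommGroup E] [NormedSpace ℝ E] [NormedAddCommGroup F] [NormedSpace ℝ F]
    (A : C(K, E →L[ℝ] F)) (γ : C(K, E)) (t : K) : pointwiseApply K E F A γ t = A t (γ t) := rfl

lemma hasFDerivAt_postcomp {E F : Type*}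
    [NormedAddCommGroup E] [NormedSpace ℝ E] [NormedAddCommGroup F] [NormedSpace ℝ F]
    (f : C(E, F)) (f' : C(E, E →L[ℝ] F)) (hf : ∀ x, HasFDerivAt f (f' x) x) (γ : C(K, E)) :
    HasFDerivAt (fun γ : C(K, E) => f.comp γ) (pointwiseApply K E F (f'.comp γ)) γ := by
  rw [hasFDerivAt_iff_isLittleO_nhds_zero, Asymptotics.isLittleO_iff]
  intro ε hε
  -- The derivative of `f` along `γ + e` is within `ε` of that along `γ`, uniformly in time.
  have hc : Continuous fun e : E => f'.comp (γ + ContinuousMap.const K e) :=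
    f'.continuous_postcomp.comp (continuous_const.add ContinuousMap.continuous_const')
  obtain ⟨δ, hδ, hball⟩ := Metric.mem_nhds_iff.1 (hc.continuousAt.preimage_mem_nhds (x := 0)
    (Metric.ball_mem_nhds (f'.comp (γ + ContinuousMap.const K 0)) hε))
  have hosc (t : K) : ∀ y ∈ Metric.ball (γ t) δ, ‖f' y - f' (γ t)‖ ≤ ε := by
    intro y hy
    have := ContinuousMap.dist_lt_iff hε |>.1
      (hball (by simpa [dist_eq_norm] using hy : y - γ t ∈ Metric.ball 0 δ)) t
    simpa [dist_eq_norm] using this.le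
  filter_upwards [Metric.ball_mem_nhds (0 : C(K, E)) hδ] with g hg
  refine (ContinuousMap.norm_le _ (by positivity)).2 fun t => ?_
  have hgt : ‖g t‖ < δ := (g.norm_coe_le_norm t).trans_lt (by simpa using hg)
  have hmean := (convex_ball (γ t) δ).norm_image_sub_le_of_norm_hasFDerivWithin_le'
    (y := γ t + g t) (fun x _ => (hf x).hasFDerivWithinAt) (hosc t)
    (Metric.mem_ball_self hδ) (by simpa using hgt)
  rw [add_sub_cancel_left] at hmean
  exact hmean.trans (mul_le_mul_of_nonneg_left (g.norm_coe_le_norm t) hε.le)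

lemma contDiff_nat_postcomp {E : Type u} [NormedAddCommGroup E] [NormedSpace ℝ E] (n : ℕ) :
    ∀ {F : Type u} [NormedAddCommGroup F] [NormedSpace ℝ F] (f : C(E, F)), ContDiff ℝ n f →
      ContDiff ℝ n (fun γ : C(K, E) => f.comp γ) := by
  induction n with
  | zero =>
    intro F _ _ f _
    exact contDiff_zero.2 f.continuous_postcomp
  | succ n ih =>
    intro F _ _ f hf
    obtain ⟨f', hf', h⟩ := contDiff_succ_iff_hasFDerivAt.1 hf
    refine contDiff_succ_iff_hasFDerivAt.2 ⟨_, ?_, fun γ =>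
      hasFDerivAt_postcomp f ⟨f', hf'.continuous⟩ h γ⟩
    exact (ContinuousLinearMap.contDiff _).comp (ih ⟨f', hf'.continuous⟩ hf')

lemma contDiff_postcomp {E F : Type u} [NormedAddCommGroup E] [NormedSpace ℝ E]
    [NormedAddCommGroup F] [NormedSpace ℝ F] (f : C(E, F)) (hf : ContDiff ℝ ∞ f) :
    ContDiff ℝ ∞ (fun γ : C(K, E) => f.comp γ) :=
  contDiff_infty.2 fun n => contDiff_nat_postcomp n f (contDiff_infty.1 hf n)

/-- The primitive vanishing at `0`, as an operator on continuous maps on `[0, 1]`. -/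
def primitive (F : Type*) [NormedAddCommGroup F] [NormedSpace ℝ F] :
    C(unitInterval, F) →L[ℝ] C(unitInterval, F) :=
  LinearMap.mkContinuous
    { toFun := fun g => ⟨fun s => ∫ t in (0 : ℝ)..s, Set.IccExtend zero_le_one g t,
        (intervalIntegral.continuous_primitive
          (fun _ _ => g.continuous.Icc_extend'.intervalIntegrable _ _) 0).comp
          continuous_subtype_val⟩
      map_add' := fun g h => ContinuousMap.ext fun _ => intervalIntegral.integral_add
        (g.continuous.Icc_extend'.intervalIntegrable _ _)
        (h.continuous.Icc_extend'.intervalIntegrable _ _)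
      map_smul' := fun r _ => ContinuousMap.ext fun _ => intervalIntegral.integral_smul r _ } 1 (by
    intro g
    refine (ContinuousMap.norm_le _ (by positivity)).2 fun s => ?_
    refine (intervalIntegral.norm_integral_le_of_norm_le_const (C := ‖g‖)
      fun t _ => g.norm_coe_le_norm _).trans ?_
    rw [sub_zero, abs_of_nonneg s.2.1, one_mul]
    exact mul_le_of_le_one_right (norm_nonneg _) s.2.2)

variable {F : Type*} [NormedAddCommGroup F] [NormedSpace ℝ F]

lemma primitive_apply (g : C(unitInterval, F)) (s : unitInterval) :
    primitive F g s = ∫ t in (0 : ℝ)..s, Set.IccExtend zero_le_one g t := rfl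

variable [CompleteSpace F]

lemma hasDerivAt_IccExtend_primitive (g : C(unitInterval, F)) {t : ℝ} (ht : t ∈ Set.Ioo (0 : ℝ) 1) :
    HasDerivAt (Set.IccExtend zero_le_one (primitive F g)) (Set.IccExtend zero_le_one g t) t := by
  have hg : Continuous (Set.IccExtend (zero_le_one' ℝ) g) := g.continuous.Icc_extend'
  refine (hg.integral_hasStrictDerivAt 0 t).hasDerivAt.congr_of_eventuallyEq ?_
  filter_upwards [Ioo_mem_nhds ht.1 ht.2] with s hs
  rw [Set.IccExtend_of_mem zero_le_one _ (Set.Ioo_subset_Icc_self hs), primitive_apply]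

lemma primitive_eq_sub_of_hasDerivAt {g w : C(unitInterval, F)}
    (hw : ∀ t ∈ Set.Ioo (0 : ℝ) 1,
      HasDerivAt (Set.IccExtend zero_le_one w) (Set.IccExtend zero_le_one g t) t) :
    primitive F g = w - ContinuousMap.const _ (w 0) := by
  ext s
  rw [primitive_apply, intervalIntegral.integral_eq_sub_of_hasDerivAt_of_le s.2.1
    w.continuous.Icc_extend'.continuousOn
    (fun t ht => hw t ⟨ht.1, ht.2.trans_le s.2.2⟩)
    (g.continuous.Icc_extend'.intervalIntegrable _ _)]
  rw [Set.IccExtend_val, Set.IccExtend_left]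
  rfl

end Paths

section Flow

open Filter Topology VectorField unitInterval

lemma eventually_forall_apply_of_tendsto_const {K Y ι : Type*} [TopologicalSpace K]
    [CompactSpace K] [TopologicalSpace Y] {l : Filter ι} {c : ι → C(K, Y)} {y : Y} {p : Y → Prop}
    (hc : Tendsto c l (𝓝 (.const K y))) (hp : ∀ᶠ z in 𝓝 y, p z) : ∀ᶠ i in l, ∀ t, p (c i t) := by
  obtain ⟨O, hO, hO_open, hyO⟩ := eventually_nhds_iff.1 hp
  filter_upwards [hc.eventually (ContinuousMap.eventually_mapsTo isCompact_univ hO_open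
    fun _ _ => hyO)] with i hi t
  exact hO _ (hi (Set.mem_univ t))

universe u

lemma lieBracket_clm_apply {V X : Type*} [NormedAddCommGroup V] [NormedSpace ℝ V]
    [NormedAddCommGroup X] [NormedSpace ℝ X] {H : V → X →L[ℝ] V} {z : V}
    (hH : DifferentiableAt ℝ H z) (ξ ζ : X) :
    lieBracket ℝ (fun z => H z ξ) (fun z => H z ζ) z =
      fderiv ℝ H z (H z ξ) ζ - fderiv ℝ H z (H z ζ) ξ := by
  have h (ξ : X) (v : V) : fderiv ℝ (fun z => H z ξ) z v = fderiv ℝ H z v ξ := by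
    rw [(hH.hasFDerivAt.clm_apply (hasFDerivAt_const ξ z)).fderiv]
    simp
  rw [lieBracket, h, h]

variable {V X : Type u} [NormedAddCommGroup V] [NormedSpace ℝ V]
  [NormedAddCommGroup X] [NormedSpace ℝ X]

/-- The defect of a path `γ` as a solution of `γ' = H(γ) ξ`, `γ(0) = z`, in integral form, as a
function of `((z, ξ), γ)`. -/
def flowDefect (H : C(V, X →L[ℝ] V)) (q : (V × X) × C(I, V)) : C(I, V) :=
  q.2 - ContinuousLinearMap.const ℝ I q.1.1
    - primitive V (pointwiseApply I X V (H.comp q.2) (ContinuousLinearMap.const ℝ I q.1.2))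

lemma contDiff_flowDefect (H : C(V, X →L[ℝ] V)) (hH : ContDiff ℝ ∞ H) :
    ContDiff ℝ ∞ (flowDefect H) := by
  have hcomp : ContDiff ℝ ∞ fun q : (V × X) × C(I, V) => H.comp q.2 :=
    (contDiff_postcomp H hH).comp contDiff_snd
  unfold flowDefect
  fun_prop

lemma fderiv_flowDefect_apply (H : C(V, X →L[ℝ] V)) (hH : ContDiff ℝ 1 H)
    (q : (V × X) × C(I, V)) (v : V) (η : X) (w : C(I, V)) :
    fderiv ℝ (flowDefect H) q ((v, η), w) = w - ContinuousLinearMap.const ℝ I v - primitive V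
      (pointwiseApply I X V (H.comp q.2) (ContinuousLinearMap.const ℝ I η) +
        pointwiseApply I X V (pointwiseApply I V (X →L[ℝ] V)
          ((⟨fderiv ℝ H, hH.continuous_fderiv one_ne_zero⟩ : C(V, V →L[ℝ] X →L[ℝ] V)).comp q.2) w)
          (ContinuousLinearMap.const ℝ I q.1.2)) := by
  have hcomp := (hasFDerivAt_postcomp H ⟨fderiv ℝ H, hH.continuous_fderiv one_ne_zero⟩
    (fun x => (hH.differentiable one_ne_zero x).hasFDerivAt) q.2).comp q
    (hasFDerivAt_snd (𝕜 := ℝ) (p := q))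
  have hconst := ((ContinuousLinearMap.const ℝ I).comp ((ContinuousLinearMap.snd ℝ V X).comp
    (ContinuousLinearMap.fst ℝ (V × X) C(I, V)))).hasFDerivAt (x := q)
  have hbase := ((ContinuousLinearMap.const ℝ I).comp ((ContinuousLinearMap.fst ℝ V X).comp
    (ContinuousLinearMap.fst ℝ (V × X) C(I, V)))).hasFDerivAt (x := q)
  have hflow : HasFDerivAt (flowDefect H) _ q :=
    ((hasFDerivAt_snd (𝕜 := ℝ) (p := q)).sub hbase).sub ((primitive V).hasFDerivAt.comp q
      ((pointwiseApply I X V).hasFDerivAt_of_bilinear hcomp hconst))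
  rw [hflow.fderiv]
  rfl

lemma isInvertible_fderiv_flowDefect_zero (H : C(V, X →L[ℝ] V)) (hH : ContDiff ℝ 1 H)
    (z : V) (γ : C(I, V)) :
    (fderiv ℝ (flowDefect H) ((z, 0), γ) ∘L .inr ℝ (V × X) C(I, V)).IsInvertible := by
  refine ⟨.refl ℝ _, ContinuousLinearMap.ext fun w => ?_⟩
  rw [ContinuousLinearMap.comp_apply, ContinuousLinearMap.inr_apply,
    show (0 : V × X) = (0, 0) from rfl, fderiv_flowDefect_apply H hH]
  simp only [map_zero, add_zero, sub_zero, ContinuousLinearEquiv.coe_refl,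
    ContinuousLinearMap.id_apply]

lemma exists_smooth_flow [CompleteSpace V] [CompleteSpace X] (H : C(V, X →L[ℝ] V))
    (hH : ContDiff ℝ ∞ H) (z₀ : V) :
    ∃ φ : V × X → C(I, V), φ (z₀, 0) = ContinuousLinearMap.const ℝ I z₀ ∧ ∀ᶠ q in 𝓝 (z₀, 0),
      ContDiffAt ℝ ∞ φ q ∧ flowDefect H (q, φ q) = 0 ∧
        ∀ v w, fderiv ℝ (flowDefect H) (q, φ q) (v, w) = 0 → fderiv ℝ φ q v = w := by
  have hsmooth := contDiff_flowDefect H hH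
  have hinv := isInvertible_fderiv_flowDefect_zero H (hH.of_le (by simp)) z₀
    (ContinuousLinearMap.const ℝ I z₀)
  have hzero : flowDefect H ((z₀, 0), ContinuousLinearMap.const ℝ I z₀) = 0 := by
    simp only [flowDefect, sub_self, map_zero]
  have himp := hsmooth.contDiffAt (x := ((z₀, 0), ContinuousLinearMap.const ℝ I z₀))
  have hbase := himp.implicitFunction_apply_self (by simp) hinv
  refine ⟨himp.implicitFunction (by simp) hinv, hbase, ?_⟩
  have hgraph : Tendsto (fun q => (q, himp.implicitFunction (by simp) hinv q)) (𝓝 (z₀, 0))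
      (𝓝 ((z₀, 0), ContinuousLinearMap.const ℝ I z₀)) := by
    have := (continuousAt_id (x := ((z₀, 0) : V × X))).prodMk
      (himp.contDiffAt_implicitFunction (by simp) hinv).continuousAt
    rwa [ContinuousAt, hbase] at this
  filter_upwards [eventually_contDiffAt_implicitFunction hsmooth (by simp) hinv,
    (himp.eventually_apply_implicitFunction (by simp) hinv).eventually_nhds,
    hgraph.eventually (eventually_isInvertible_fderiv_comp_inr hsmooth (by simp) hinv)]
    with q hq hdefect hq_inv
  exact ⟨hq, hdefect.self_of_nhds.trans hzero, fun v w hvw =>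
    fderiv_eq_of_eventually_apply_eq (hsmooth.differentiable (by simp) _)
      (hq.differentiableAt (by simp)) hdefect hq_inv.injective hvw⟩

/-- `(1 - t) • H (c t) ζ` is the variation of the integral curve `c` of `H ξ` when its initial point
slides along `H ζ` while the direction `ξ` is diminished by `ζ`. -/
lemma hasDerivAt_variation {H : V → X →L[ℝ] V} {c : ℝ → V} {t : ℝ} {ξ ζ : X}
    (hH : DifferentiableAt ℝ H (c t)) (hc : HasDerivAt c (H (c t) ξ) t)
    (hcomm : lieBracket ℝ (fun z => H z ξ) (fun z => H z ζ) (c t) = 0) :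
    HasDerivAt (fun t => (1 - t) • H (c t) ζ)
      (H (c t) (-ζ) + fderiv ℝ H (c t) ((1 - t) • H (c t) ζ) ξ) t := by
  rw [lieBracket_clm_apply hH, sub_eq_zero] at hcomm
  have hHc := (hH.hasFDerivAt.comp_hasDerivAt t hc).clm_apply (hasDerivAt_const t ζ)
  convert! ((hasDerivAt_id t).const_sub 1).smul hHc using 1
  simp [hcomm, add_comm]

lemma apply_zero_of_flowDefect_eq_zero {H : C(V, X →L[ℝ] V)} {z : V} {ξ : X} {γ : C(I, V)}
    (hγ : flowDefect H ((z, ξ), γ) = 0) : γ 0 = z := by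
  have h0 := DFunLike.congr_fun hγ 0
  simpa [flowDefect, primitive_apply, sub_eq_zero] using h0

lemma fderiv_flow_retract_apply {φ : V × X → C(I, V)} {π : V →L[ℝ] X} {z₀ z : V}
    (hφ : DifferentiableAt ℝ φ (z, π (z₀ - z))) (v : V) :
    fderiv ℝ (fun z => φ (z, π (z₀ - z)) 1) z v = fderiv ℝ φ (z, π (z₀ - z)) (v, -π v) 1 := by
  have hretract := (hasFDerivAt_id z).prodMk
    (π.hasFDerivAt.comp z ((hasFDerivAt_id z).const_sub z₀))
  have hcomp := (ContinuousMap.evalCLM ℝ (1 : I)).hasFDerivAt.comp z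
    (hφ.hasFDerivAt.comp z hretract)
  exact (DFunLike.congr_fun hcomp.fderiv v).trans (by simp)

variable [CompleteSpace V]

lemma hasDerivAt_IccExtend_of_flowDefect_eq_zero {H : C(V, X →L[ℝ] V)} {z : V} {ξ : X}
    {γ : C(I, V)} (hγ : flowDefect H ((z, ξ), γ) = 0) {t : ℝ} (ht : t ∈ Set.Ioo (0 : ℝ) 1) :
    HasDerivAt (Set.IccExtend zero_le_one γ) (H (Set.IccExtend zero_le_one γ t) ξ) t := by
  have hγ' : γ = ContinuousLinearMap.const ℝ I z +
      primitive V (pointwiseApply I X V (H.comp γ) (ContinuousLinearMap.const ℝ I ξ)) := by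
    rw [← sub_eq_iff_eq_add']
    exact sub_eq_zero.1 hγ
  have := (hasDerivAt_IccExtend_primitive
    (pointwiseApply I X V (H.comp γ) (ContinuousLinearMap.const ℝ I ξ)) ht).const_add z
  refine this.congr_of_eventuallyEq (.of_forall fun s => ?_)
  exact DFunLike.congr_fun hγ' _

lemma fderiv_flowDefect_eq_zero_of_lieBracket_eq_zero {H : C(V, X →L[ℝ] V)} (hH : ContDiff ℝ 1 H)
    {z : V} {ξ : X} {γ : C(I, V)} (hγ : flowDefect H ((z, ξ), γ) = 0) (ζ : X)
    (hcomm : ∀ s, lieBracket ℝ (fun z => H z ξ) (fun z => H z ζ) (γ s) = 0) :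
    ∃ w : C(I, V), w 1 = 0 ∧
      fderiv ℝ (flowDefect H) ((z, ξ), γ) ((H z ζ, -ζ), w) = 0 := by
  let w : C(I, V) := ⟨fun s => (1 - (s : ℝ)) • H (γ s) ζ, by fun_prop⟩
  refine ⟨w, by simp [w], ?_⟩
  have hw0 : w 0 = H z ζ := by simp [w, apply_zero_of_flowDefect_eq_zero hγ]
  rw [fderiv_flowDefect_apply H hH, primitive_eq_sub_of_hasDerivAt (w := w), hw0]
  · exact sub_self _
  intro t ht
  have ht' := Set.Ioo_subset_Icc_self ht
  have hvar := hasDerivAt_variation (hH.differentiable one_ne_zero _)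
    (hasDerivAt_IccExtend_of_flowDefect_eq_zero hγ ht) (ζ := ζ) (hcomm _)
  convert! hvar.congr_of_eventuallyEq (f₁ := Set.IccExtend zero_le_one w) ?_ using 1
  · simp [Set.IccExtend_of_mem zero_le_one _ ht', w]
  · filter_upwards [Ioo_mem_nhds ht.1 ht.2] with s hs
    simp [Set.IccExtend_of_mem zero_le_one _ (Set.Ioo_subset_Icc_self hs), w]

lemma fderiv_flowDefect_const_apply {H : C(V, X →L[ℝ] V)} (hH : ContDiff ℝ 1 H) (z v : V) (η : X) :
    ∃ w : C(I, V), w 1 = v + H z η ∧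
      fderiv ℝ (flowDefect H) ((z, 0), ContinuousLinearMap.const ℝ I z) ((v, η), w) = 0 := by
  refine ⟨ContinuousLinearMap.const ℝ I v + primitive V (ContinuousLinearMap.const ℝ I (H z η)),
    ?_, ?_⟩
  · have hconst : Set.IccExtend (zero_le_one' ℝ) (ContinuousLinearMap.const ℝ I (H z η)) =
      fun _ => H z η := rfl
    simp [primitive_apply, hconst]
  · rw [fderiv_flowDefect_apply H hH]
    simp only [map_zero, add_zero, add_sub_cancel_left]
    exact sub_self _

/-- The first integrals are the components of the map which takes a point along the flow of the
frame `H` to the transversal `{π z = π z₀}`. -/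
theorem exists_firstIntegrals_of_lieBracket_eq_zero [CompleteSpace X] {H : C(V, X →L[ℝ] V)}
    (hH : ContDiff ℝ ∞ H) (π : V →L[ℝ] X) {z₀ : V} (hπ : ∀ᶠ z in 𝓝 z₀, ∀ ξ, π (H z ξ) = ξ)
    (hcomm : ∀ᶠ z in 𝓝 z₀, ∀ ξ ζ, lieBracket ℝ (fun z => H z ξ) (fun z => H z ζ) z = 0) :
    ∃ f : V → V, (∀ᶠ z in 𝓝 z₀, ContDiffAt ℝ ∞ f z ∧ ∀ ζ, fderiv ℝ f z (H z ζ) = 0) ∧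
      ∀ v, fderiv ℝ f z₀ v = v - H z₀ (π v) := by
  have hH1 : ContDiff ℝ 1 H := hH.of_le (by simp)
  obtain ⟨φ, hφ₀, hφ⟩ := exists_smooth_flow H hH z₀
  have hφz₀ := hφ.self_of_nhds
  have hretract_smooth : ContDiff ℝ ∞ fun z => (z, π (z₀ - z)) := by fun_prop
  have hretract₀ : (z₀, π (z₀ - z₀)) = (z₀, 0) := by simp
  have hretract : Tendsto (fun z => (z, π (z₀ - z))) (𝓝 z₀) (𝓝 (z₀, 0)) :=
    hretract₀ ▸ hretract_smooth.continuous.tendsto z₀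
  have hpath : Tendsto (fun z => φ (z, π (z₀ - z))) (𝓝 z₀)
      (𝓝 (ContinuousLinearMap.const ℝ I z₀)) := by
    have := hφz₀.1.continuousAt.tendsto.comp hretract
    rwa [hφ₀] at this
  refine ⟨fun z => φ (z, π (z₀ - z)) 1, ?_, fun v => ?_⟩
  · filter_upwards [hretract.eventually hφ, hπ,
      eventually_forall_apply_of_tendsto_const hpath hcomm]
      with z ⟨hφz, hdefect, hunique⟩ hπz hcommz
    refine ⟨(ContinuousMap.evalCLM ℝ (1 : I) : C(I, V) →L[ℝ] V).contDiff.contDiffAt.comp z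
      (hφz.comp (f := fun z => (z, π (z₀ - z))) z hretract_smooth.contDiffAt), fun ζ => ?_⟩
    obtain ⟨w, hw1, hw⟩ := fderiv_flowDefect_eq_zero_of_lieBracket_eq_zero hH1 hdefect ζ
      fun s => hcommz s _ _
    rw [fderiv_flow_retract_apply (hφz.differentiableAt (by simp)), hπz, hunique _ w hw, hw1]
  · obtain ⟨w, hw1, hw⟩ := fderiv_flowDefect_const_apply hH1 z₀ v (-π v)
    rw [fderiv_flow_retract_apply (hretract₀ ▸ hφz₀.1.differentiableAt (by simp)), hretract₀,
      hφz₀.2.2 _ w (hφ₀ ▸ hw), hw1, map_neg, ← sub_eq_add_neg]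

end Flow

section Frames

open Filter Topology VectorField

lemma apply_apply_of_mem_range {K V W X : Type*} [DivisionRing K] [AddCommGroup V] [Module K V]
    [AddCommGroup W] [Module K W] [AddCommGroup X] [Module K X] {L : W →ₗ[K] V} {B : X →ₗ[K] W}
    {π : V →ₗ[K] X} [FiniteDimensional K (LinearMap.range L)] (hπ : ∀ ξ, π (L (B ξ)) = ξ)
    (hrank : Module.finrank K (LinearMap.range L) = Module.finrank K X) {v : V}
    (hv : v ∈ LinearMap.range L) : L (B (π v)) = v := by
  have hinj : Function.Injective (L ∘ₗ B) :=
    (show Function.LeftInverse π (L ∘ₗ B) from hπ).injective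
  have hrange : LinearMap.range (L ∘ₗ B) = LinearMap.range L :=
    Submodule.eq_of_le_of_finrank_eq (LinearMap.range_comp_le_range B L)
      (by rw [LinearMap.finrank_range_of_inj hinj, hrank])
  obtain ⟨ξ, rfl⟩ := hrange ▸ hv
  simp only [LinearMap.comp_apply, hπ]

lemma exists_comp_comp_eq_id_of_finiteDimensional_range {V W : Type*}
    [NormedAddCommGroup V] [NormedSpace ℝ V] [NormedAddCommGroup W] [NormedSpace ℝ W]
    (L : W →L[ℝ] V) [FiniteDimensional ℝ (LinearMap.range L.toLinearMap)] :
    ∃ (π : V →L[ℝ] LinearMap.range L.toLinearMap) (σ : LinearMap.range L.toLinearMap →L[ℝ] W),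
      π ∘L L ∘L σ = .id ℝ _ := by
  obtain ⟨π, hπ⟩ :=
    Submodule.ClosedComplemented.of_finiteDimensional (𝕜 := ℝ) (LinearMap.range L.toLinearMap)
  obtain ⟨σ, hσ⟩ := L.toLinearMap.rangeRestrict.exists_rightInverse_of_surjective
    (LinearMap.range_rangeRestrict _)
  refine ⟨π, LinearMap.toContinuousLinearMap σ, ContinuousLinearMap.ext fun x => ?_⟩
  have hx : L (σ x) = x := congrArg Subtype.val (LinearMap.congr_fun hσ x)
  simp [hx, hπ]

variable {V W X : Type*} [NormedAddCommGroup V] [NormedSpace ℝ V] [NormedAddCommGroup W]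
  [NormedSpace ℝ W] [NormedAddCommGroup X] [NormedSpace ℝ X]

lemma exists_contDiff_rightInverse [CompleteSpace X] {P : V → W →L[ℝ] V} {z₀ : V}
    (hP : ∀ᶠ z in 𝓝 z₀, ContDiffAt ℝ ∞ P z) {π : V →L[ℝ] X} {σ : X →L[ℝ] W}
    (hσ : π ∘L P z₀ ∘L σ = .id ℝ X) :
    ∃ B : V → X →L[ℝ] W, ∀ᶠ z in 𝓝 z₀, ContDiffAt ℝ ∞ B z ∧ ∀ ξ, π (P z (B z ξ)) = ξ := by
  have hT {z : V} (hz : ContDiffAt ℝ ∞ P z) : ContDiffAt ℝ ∞ (fun z => π ∘L P z ∘L σ) z := by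
    fun_prop
  refine ⟨fun z => σ ∘L Ring.inverse (π ∘L P z ∘L σ), ?_⟩
  have hunit : {S : X →L[ℝ] X | IsUnit S} ∈ 𝓝 (π ∘L P z₀ ∘L σ) :=
    Units.isOpen.mem_nhds (hσ ▸ isUnit_one)
  filter_upwards [hP, (hT hP.self_of_nhds).continuousAt.preimage_mem_nhds hunit] with z hz hzT
  refine ⟨?_, fun ξ => DFunLike.congr_fun (Ring.mul_inverse_cancel _ hzT) ξ⟩
  obtain ⟨S, hS : (S : X →L[ℝ] X) = π ∘L P z ∘L σ⟩ := hzT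
  have hinverse : ContDiffAt ℝ ∞ (Ring.inverse ∘ fun z => π ∘L P z ∘L σ) z :=
    ContDiffAt.comp z (by rw [← hS]; exact contDiffAt_ringInverse ℝ S) (hT hz)
  exact contDiffAt_const.clm_comp hinverse

lemma fderiv_clm_comp_apply {P : V → W →L[ℝ] V} {B : V → X →L[ℝ] W} {z : V}
    (hP : DifferentiableAt ℝ P z) (hB : DifferentiableAt ℝ B z) (v : V) (ξ : X) :
    fderiv ℝ (fun z => P z ∘L B z) z v ξ =
      fderiv ℝ P z v (B z ξ) + P z (fderiv ℝ B z v ξ) := by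
  rw [(hP.hasFDerivAt.clm_comp hB.hasFDerivAt).fderiv]
  exact add_comm _ _

lemma lieBracket_clm_comp_mem_range {P : V → W →L[ℝ] V} {B : V → X →L[ℝ] W} {z : V}
    (hP : DifferentiableAt ℝ P z) (hB : DifferentiableAt ℝ B z)
    (hinv : ∀ α β, lieBracket ℝ (fun z => P z α) (fun z => P z β) z ∈
      LinearMap.range (P z).toLinearMap) (ξ ζ : X) :
    lieBracket ℝ (fun z => P z (B z ξ)) (fun z => P z (B z ζ)) z ∈
      LinearMap.range (P z).toLinearMap := by
  have hPB := lieBracket_clm_apply (H := fun z => P z ∘L B z) (hP.clm_comp hB) ξ ζ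
  rw [fderiv_clm_comp_apply hP hB, fderiv_clm_comp_apply hP hB, add_sub_add_comm, ← map_sub] at hPB
  refine hPB ▸ Submodule.add_mem _ ?_ ⟨_, rfl⟩
  exact lieBracket_clm_apply hP (B z ξ) (B z ζ) ▸ hinv _ _

lemma apply_lieBracket_eq_zero_of_leftInverse {H : V → X →L[ℝ] V} {π : V →L[ℝ] X} {z : V}
    (hH : DifferentiableAt ℝ H z) (hπ : ∀ᶠ y in 𝓝 z, ∀ ξ, π (H y ξ) = ξ) (ξ ζ : X) :
    π (lieBracket ℝ (fun z => H z ξ) (fun z => H z ζ) z) = 0 := by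
  have hconst (v : V) (ξ : X) : π (fderiv ℝ H z v ξ) = 0 := by
    have hderiv := π.hasFDerivAt.comp z (hH.hasFDerivAt.clm_apply (hasFDerivAt_const ξ z))
    have hzero := hderiv.unique
      ((hasFDerivAt_const ξ z).congr_of_eventuallyEq (hπ.mono fun y hy => hy ξ))
    simpa using DFunLike.congr_fun hzero v
  rw [lieBracket_clm_apply hH, map_sub, hconst, hconst, sub_zero]

lemma exists_contDiff_eventuallyEq [FiniteDimensional ℝ V] {A : V → W} {z₀ : V}
    (hA : ∀ᶠ z in 𝓝 z₀, ContDiffAt ℝ ∞ A z) : ∃ A' : V → W, ContDiff ℝ ∞ A' ∧ A' =ᶠ[𝓝 z₀] A := by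
  obtain ⟨δ, hδ, hball⟩ := Metric.eventually_nhds_iff_ball.1 hA
  let b : ContDiffBump z₀ := ⟨δ / 4, δ / 2, by positivity, by linarith⟩
  refine ⟨fun z => b z • A z, contDiff_iff_contDiffAt.2 fun z => ?_, ?_⟩
  · by_cases hz : z ∈ Metric.ball z₀ δ
    · exact b.contDiff.contDiffAt.smul (hball z hz)
    · have hz' : z ∉ tsupport b := fun h =>
        hz (Metric.closedBall_subset_ball (half_lt_self hδ) (b.tsupport_eq ▸ h))
      refine (contDiffAt_const (c := (0 : W))).congr_of_eventuallyEq ?_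
      filter_upwards [(isClosed_tsupport b).isOpen_compl.mem_nhds hz'] with w hw
      rw [image_eq_zero_of_notMem_tsupport hw, zero_smul]
  · filter_upwards [b.eventuallyEq_one] with z hz
    simp [hz]

end Frames

section Frobenius

open Filter Topology VectorField

universe u

variable {V : Type u} [NormedAddCommGroup V] [NormedSpace ℝ V] [FiniteDimensional ℝ V]
  {W G : Type*} [NormedAddCommGroup W] [NormedSpace ℝ W] [NormedAddCommGroup G] [NormedSpace ℝ G]

/-- The frame projecting to a constant frame commutes: its brackets are tangent to the
distribution and project to zero. -/
lemma exists_commuting_frame {P : V → W →L[ℝ] V} {z₀ : V}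
    (hP : ∀ᶠ z in 𝓝 z₀, ContDiffAt ℝ ∞ P z)
    (hinv : ∀ᶠ z in 𝓝 z₀, ∀ α β, lieBracket ℝ (fun z => P z α) (fun z => P z β) z ∈
      LinearMap.range (P z).toLinearMap)
    (hrank : ∀ᶠ z in 𝓝 z₀, Module.finrank ℝ (LinearMap.range (P z).toLinearMap) =
      Module.finrank ℝ (LinearMap.range (P z₀).toLinearMap)) :
    ∃ (π : V →L[ℝ] LinearMap.range (P z₀).toLinearMap)
      (H : V → LinearMap.range (P z₀).toLinearMap →L[ℝ] V), ∀ᶠ z in 𝓝 z₀, ContDiffAt ℝ ∞ H z ∧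
        (∀ ξ, π (H z ξ) = ξ) ∧
        (∀ ξ ζ, lieBracket ℝ (fun z => H z ξ) (fun z => H z ζ) z = 0) ∧
        (∀ ξ, H z ξ ∈ LinearMap.range (P z).toLinearMap) ∧ ∀ α, H z (π (P z α)) = P z α := by
  have : CompleteSpace (LinearMap.range (P z₀).toLinearMap) := FiniteDimensional.complete ℝ _
  obtain ⟨π, σ, hσ⟩ := exists_comp_comp_eq_id_of_finiteDimensional_range (P z₀)
  obtain ⟨B, hB⟩ := exists_contDiff_rightInverse hP hσ
  refine ⟨π, fun z => P z ∘L B z, ?_⟩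
  filter_upwards [hP, hB, hB.eventually_nhds, hinv, hrank] with z hPz ⟨hBz, hπz⟩ hBz' hinvz hrankz
  have hrange {v : V} (hv : v ∈ LinearMap.range (P z).toLinearMap) : P z (B z (π v)) = v :=
    apply_apply_of_mem_range (B := (B z).toLinearMap) (π := π.toLinearMap) hπz hrankz hv
  have hdP := hPz.differentiableAt (by simp)
  have hdB := hBz.differentiableAt (by simp)
  refine ⟨hPz.clm_comp hBz, hπz, fun ξ ζ => ?_, fun ξ => ⟨_, rfl⟩, fun α => hrange ⟨α, rfl⟩⟩
  have hmem := lieBracket_clm_comp_mem_range hdP hdB hinvz ξ ζ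
  have hzero := apply_lieBracket_eq_zero_of_leftInverse (hdP.clm_comp hdB)
    (hBz'.mono fun y hy => hy.2) ξ ζ
  have := hrange hmem
  simp only [ContinuousLinearMap.comp_apply] at hzero ⊢
  rw [← this, hzero, map_zero, map_zero]

theorem exists_firstIntegral_of_involutive {P : V → W →L[ℝ] V} {z₀ : V}
    (hP : ∀ᶠ z in 𝓝 z₀, ContDiffAt ℝ ∞ P z)
    (hinv : ∀ᶠ z in 𝓝 z₀, ∀ α β, lieBracket ℝ (fun z => P z α) (fun z => P z β) z ∈
      LinearMap.range (P z).toLinearMap)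
    (hrank : ∀ᶠ z in 𝓝 z₀, Module.finrank ℝ (LinearMap.range (P z).toLinearMap) =
      Module.finrank ℝ (LinearMap.range (P z₀).toLinearMap))
    {l : V →L[ℝ] G} (hl : ∀ α, l (P z₀ α) = 0) :
    ∃ F : V → G, (∀ᶠ z in 𝓝 z₀, ContDiffAt ℝ ∞ F z ∧ ∀ α, fderiv ℝ F z (P z α) = 0) ∧
      fderiv ℝ F z₀ = l := by
  have : CompleteSpace V := FiniteDimensional.complete ℝ V
  have : CompleteSpace (LinearMap.range (P z₀).toLinearMap) := FiniteDimensional.complete ℝ _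
  obtain ⟨π, H, hH⟩ := exists_commuting_frame hP hinv hrank
  obtain ⟨H', hH', heq⟩ := exists_contDiff_eventuallyEq (hH.mono fun z hz => hz.1)
  obtain ⟨f, hf, hf₀⟩ := exists_firstIntegrals_of_lieBracket_eq_zero
    (H := ⟨H', hH'.continuous⟩) hH' π
    (by filter_upwards [heq, hH] with z hz hHz ξ
        exact (congrArg (fun S => π (S ξ)) hz).trans (hHz.2.1 ξ))
    (by filter_upwards [heq.eventually_nhds, hH] with z hz hHz ξ ζ
        rw [← hHz.2.2.1 ξ ζ]
        exact EventuallyEq.lieBracket_vectorField_eq (hz.mono fun y hy => DFunLike.congr_fun hy ξ)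
          (hz.mono fun y hy => DFunLike.congr_fun hy ζ))
  have hderiv {z : V} (hz : ContDiffAt ℝ ∞ f z) (v : V) :
      fderiv ℝ (fun z => l (f z)) z v = l (fderiv ℝ f z v) :=
    DFunLike.congr_fun
      (l.hasFDerivAt.comp z (hz.differentiableAt (by simp)).hasFDerivAt).fderiv v
  refine ⟨fun z => l (f z), ?_, ?_⟩
  · filter_upwards [hf, hH, heq] with z ⟨hfz, hfH⟩ hHz hz
    refine ⟨l.contDiff.contDiffAt.comp z hfz, fun α => ?_⟩
    rw [hderiv hfz, ← hHz.2.2.2.2 α, ← hz]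
    exact (congrArg l (hfH _)).trans (map_zero l)
  · ext v
    obtain ⟨α, hα⟩ := hH.self_of_nhds.2.2.2.1 (π v)
    rw [hderiv hf.self_of_nhds.1, hf₀, map_sub]
    change l v - l (H' z₀ (π v)) = l v
    rw [heq.self_of_nhds, ← hα]
    exact (congrArg _ (hl α)).trans (sub_zero _)

end Frobenius

/-! ### Local Casimir functions -/

lemma formRank_compl₁₂ {K V W : Type*} [Field K] [AddCommGroup V] [Module K V] [AddCommGroup W]
    [Module K W] (B : LinearMap.BilinForm K V) {f : W →ₗ[K] V} (hf : Function.Surjective f) :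
    formRank (B.compl₁₂ f f : LinearMap.BilinForm K W) = formRank B := by
  have h : (B.compl₁₂ f f : LinearMap.BilinForm K W) = f.dualMap ∘ₗ B ∘ₗ f := rfl
  rw [formRank, formRank, h, LinearMap.range_comp, LinearMap.range_comp_of_range_eq_top _
    (LinearMap.range_eq_top.2 hf)]
  exact (Submodule.equivMapOfInjective _
    (LinearMap.dualMap_injective_of_surjective hf) _).finrank_eq.symm

section PoissonVectorSpace

open Filter Topology VectorField

variable {V : Type*} [NormedAddCommGroup V] [NormedSpace ℝ V] [FiniteDimensional ℝ V]

/-- The anchor `α ↦ B(α, ·)` of a bilinear form on covectors, with the bidual identified with the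
vector space. -/
def anchor (B : LinearMap.BilinForm ℝ (Module.Dual ℝ V)) : (V →L[ℝ] ℝ) →L[ℝ] V :=
  LinearMap.toContinuousLinearMap ((Module.evalEquiv ℝ V).symm.toLinearMap ∘ₗ B ∘ₗ
    (LinearMap.toContinuousLinearMap (𝕜 := ℝ) (E := V) (F' := ℝ)).symm.toLinearMap)

lemma apply_anchor (B : LinearMap.BilinForm ℝ (Module.Dual ℝ V)) (α : V →L[ℝ] ℝ)
    (β : Module.Dual ℝ V) : β (anchor B α) = B α.toLinearMap β :=
  Module.apply_evalEquiv_symm_apply ℝ V β (B α.toLinearMap)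

lemma finrank_range_anchor (B : LinearMap.BilinForm ℝ (Module.Dual ℝ V)) :
    Module.finrank ℝ (LinearMap.range (anchor B).toLinearMap) = formRank B := by
  have h : (anchor B).toLinearMap = (Module.evalEquiv ℝ V).symm.toLinearMap ∘ₗ B ∘ₗ
    (LinearMap.toContinuousLinearMap (𝕜 := ℝ) (E := V) (F' := ℝ)).symm.toLinearMap := rfl
  rw [h, LinearMap.range_comp, LinearMap.range_comp_of_range_eq_top _ (LinearEquiv.range _)]
  exact LinearEquiv.finrank_map_eq (Module.evalEquiv ℝ V).symm _

lemma contDiffOn_anchor {π : V → LinearMap.BilinForm ℝ (Module.Dual ℝ V)} {S : Set V}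
    {n : WithTop ℕ∞} (hπ : ∀ α β, ContDiffOn ℝ n (fun z => π z α β) S) :
    ContDiffOn ℝ n (fun z => anchor (π z)) S := by
  refine contDiffOn_clm_apply.2 fun α => ?_
  let b := Module.finBasis ℝ V
  rw [← b.equivFunL.comp_contDiffOn_iff]
  refine contDiffOn_pi.2 fun i => ?_
  convert! hπ α.toLinearMap (b.coord i) using 2 with z
  exact apply_anchor (π z) α (b.coord i)

lemma apply_fderiv_anchor {π : V → LinearMap.BilinForm ℝ (Module.Dual ℝ V)} {z : V}
    (hπ : DifferentiableAt ℝ (fun z => anchor (π z)) z) (α : V →L[ℝ] ℝ) (γ : Module.Dual ℝ V)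
    (v : V) : γ (fderiv ℝ (fun z => anchor (π z)) z v α) =
      fderiv ℝ (fun z => π z α.toLinearMap γ) z v := by
  let γ' : V →L[ℝ] ℝ := LinearMap.toContinuousLinearMap γ
  have hderiv := γ'.hasFDerivAt.comp z (hπ.hasFDerivAt.clm_apply (hasFDerivAt_const α z))
  have heq : γ' ∘ (fun z => anchor (π z) α) = fun z => π z α.toLinearMap γ :=
    funext fun z => apply_anchor (π z) α γ
  rw [← heq, hderiv.fderiv]
  simp [γ']

lemma lieBracket_anchor {π : V → LinearMap.BilinForm ℝ (Module.Dual ℝ V)} {z : V}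
    (hπ : DifferentiableAt ℝ (fun z => anchor (π z)) z) (halt : ∀ᶠ y in 𝓝 z, (π y).IsAlt)
    (hjac : ∀ α β γ, π z α (fderiv ℝ (fun z => π z β γ) z).toLinearMap
      + π z β (fderiv ℝ (fun z => π z γ α) z).toLinearMap
      + π z γ (fderiv ℝ (fun z => π z α β) z).toLinearMap = 0) (α β : V →L[ℝ] ℝ) :
    lieBracket ℝ (fun z => anchor (π z) α) (fun z => anchor (π z) β) z =
      anchor (π z) (fderiv ℝ (fun z => π z α.toLinearMap β.toLinearMap) z) := by
  refine sub_eq_zero.1 ((Module.forall_dual_apply_eq_zero_iff ℝ _).1 fun γ => ?_)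
  have hskew : fderiv ℝ (fun z => π z γ α.toLinearMap) z =
      -fderiv ℝ (fun z => π z α.toLinearMap γ) z := by
    rw [← fderiv_fun_neg]
    exact EventuallyEq.fderiv_eq (halt.mono fun y hy => (hy.neg_eq _ _).symm)
  have hJ := hjac α.toLinearMap β.toLinearMap γ
  rw [hskew, ← apply_anchor, ← apply_anchor, ← halt.self_of_nhds.neg_eq] at hJ
  rw [lieBracket_clm_apply hπ, map_sub, map_sub, apply_fderiv_anchor hπ, apply_fderiv_anchor hπ,
    apply_anchor]
  simpa [sub_eq_add_neg, add_assoc] using hJ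

theorem exists_casimir_vectorSpace {π : V → LinearMap.BilinForm ℝ (Module.Dual ℝ V)} {z₀ : V}
    (hπ : ∀ᶠ z in 𝓝 z₀, ∀ α β, ContDiffAt ℝ ∞ (fun z => π z α β) z)
    (halt : ∀ᶠ z in 𝓝 z₀, (π z).IsAlt)
    (hjac : ∀ᶠ z in 𝓝 z₀, ∀ α β γ, π z α (fderiv ℝ (fun z => π z β γ) z).toLinearMap
      + π z β (fderiv ℝ (fun z => π z γ α) z).toLinearMap
      + π z γ (fderiv ℝ (fun z => π z α β) z).toLinearMap = 0)
    (hrank : ∀ᶠ z in 𝓝 z₀, formRank (π z) = formRank (π z₀))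
    {l : V →L[ℝ] ℝ} (hl : π z₀ l.toLinearMap = 0) :
    ∃ F : V → ℝ, (∀ᶠ z in 𝓝 z₀, ContDiffAt ℝ ∞ F z ∧ π z (fderiv ℝ F z).toLinearMap = 0) ∧
      fderiv ℝ F z₀ = l := by
  have hskew {z : V} (hz : (π z).IsAlt) (α β : V →L[ℝ] ℝ) :
      π z α.toLinearMap β.toLinearMap = -α (anchor (π z) β) := by
    rw [← hz.neg_eq]
    exact congrArg Neg.neg (apply_anchor (π z) β α.toLinearMap).symm
  have hsmooth : ∀ᶠ z in 𝓝 z₀, ContDiffAt ℝ ∞ (fun z => anchor (π z)) z := by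
    obtain ⟨S, hS, hS_open, hz₀⟩ := eventually_nhds_iff.1 hπ
    filter_upwards [hS_open.mem_nhds hz₀] with z hz
    exact (contDiffOn_anchor fun α β y hy => (hS y hy α β).contDiffWithinAt).contDiffAt
      (hS_open.mem_nhds hz)
  obtain ⟨F, hF, hF₀⟩ := exists_firstIntegral_of_involutive (P := fun z => anchor (π z)) hsmooth
    (by filter_upwards [hsmooth, halt.eventually_nhds, hjac] with z hsmoothz haltz hjacz α β
        rw [lieBracket_anchor (hsmoothz.differentiableAt (by simp)) haltz hjacz]
        exact ⟨_, rfl⟩)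
    (by simpa only [finrank_range_anchor] using hrank) (l := l)
    (fun α => by rw [← neg_eq_zero, ← hskew halt.self_of_nhds, hl, LinearMap.zero_apply])
  refine ⟨F, ?_, hF₀⟩
  filter_upwards [hF, halt] with z ⟨hFz, hcas⟩ haltz
  refine ⟨hFz, LinearMap.ext fun β => ?_⟩
  have := hskew haltz (fderiv ℝ F z) (LinearMap.toContinuousLinearMap β)
  rwa [hcas, neg_zero] at this

end PoissonVectorSpace

section PoissonManifold

open Filter Topology

variable {F : Type*} [NormedAddCommGroup F] [NormedSpace ℝ F]
  {N : Type*} [TopologicalSpace N] [ChartedSpace F N]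

/-- The differential at `q` of the preferred chart at `x`. -/
def chartDifferential (F : Type*) [NormedAddCommGroup F] [NormedSpace ℝ F]
    {N : Type*} [TopologicalSpace N] [ChartedSpace F N] (x q : N) : F →L[ℝ] F :=
  mfderiv 𝓘(ℝ, F) 𝓘(ℝ, F) (chartAt F x) q

lemma differential_congr {f g : N → ℝ} {x : N} (h : f =ᶠ[𝓝 x] g) :
    differential (F := F) f x = differential g x :=
  congrArg (fun L : F →L[ℝ] ℝ => L.toLinearMap) h.mfderiv_eq

/-- The expression of a tensor field in the preferred chart at `x`. -/
def chartTensor (c : TensorField F N) (x : N) (z : F) :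
    LinearMap.BilinForm ℝ (Module.Dual ℝ F) :=
  (c ((chartAt F x).symm z)).compl₁₂
    (chartDifferential F x ((chartAt F x).symm z)).toLinearMap.dualMap
    (chartDifferential F x ((chartAt F x).symm z)).toLinearMap.dualMap

lemma chartTensor_chartAt (c : TensorField F N) {x q : N} (hq : q ∈ (chartAt F x).source) :
    chartTensor c x (chartAt F x q) = (c q).compl₁₂
      (chartDifferential F x q).toLinearMap.dualMap
      (chartDifferential F x q).toLinearMap.dualMap := by
  rw [chartTensor, (chartAt F x).left_inv hq]

variable [IsManifold 𝓘(ℝ, F) ∞ N]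

lemma dualMap_chartDifferential_surjective {x q : N} (hq : q ∈ (chartAt F x).source) :
    Function.Surjective (chartDifferential F x q).toLinearMap.dualMap := by
  have : IsManifold 𝓘(ℝ, F) 1 N := IsManifold.of_le (n := ∞) (by simp)
  exact LinearMap.dualMap_surjective_of_injective
    ((mdifferentiable_chart (I := 𝓘(ℝ, F)) x).mfderiv_bijective hq).1

lemma formRank_chartTensor (c : TensorField F N) {x : N} {z : F} (hz : z ∈ (chartAt F x).target) :
    formRank (chartTensor c x z) = formRank (c ((chartAt F x).symm z)) :=
  formRank_compl₁₂ _ (dualMap_chartDifferential_surjective ((chartAt F x).map_target hz))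

lemma chartTensor_chartAt_apply_eq_zero_iff (c : TensorField F N) {x q : N}
    (hq : q ∈ (chartAt F x).source) (α : Module.Dual ℝ F) :
    chartTensor c x (chartAt F x q) α = 0 ↔
      c q ((chartDifferential F x q).toLinearMap.dualMap α) = 0 := by
  rw [chartTensor_chartAt c hq]
  exact LinearMap.cancel_right (f := c q ((chartDifferential F x q).toLinearMap.dualMap α))
    (f' := 0) (dualMap_chartDifferential_surjective hq)

lemma differential_comp_chart {x q : N} (hq : q ∈ (chartAt F x).source) {G : F → ℝ}
    (hG : DifferentiableAt ℝ G (chartAt F x q)) :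
    differential (F := F) (fun y => G (chartAt F x y)) q =
      (chartDifferential F x q).toLinearMap.dualMap
        (fderiv ℝ G (chartAt F x q)).toLinearMap := by
  have : IsManifold 𝓘(ℝ, F) 1 N := IsManifold.of_le (n := ∞) (by simp)
  have hcomp := mfderiv_comp (I := 𝓘(ℝ, F)) (I' := 𝓘(ℝ, F)) (I'' := 𝓘(ℝ, ℝ)) q
    hG.mdifferentiableAt (mdifferentiableAt_atlas (chart_mem_atlas F x) hq)
  rw [mfderiv_eq_fderiv] at hcomp
  exact congrArg (fun L : F →L[ℝ] ℝ => L.toLinearMap) hcomp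

variable [FiniteDimensional ℝ F]

lemma smoothOn_coordinate (x : N) (α : Module.Dual ℝ F) :
    SmoothOn F (fun y => α (chartAt F x y)) (chartAt F x).source :=
  (LinearMap.toContinuousLinearMap α).contMDiff.comp_contMDiffOn contMDiffOn_chart

lemma differential_coordinate {x q : N} (hq : q ∈ (chartAt F x).source) (α : Module.Dual ℝ F) :
    differential (F := F) (fun y => α (chartAt F x y)) q =
      (chartDifferential F x q).toLinearMap.dualMap α := by
  have h := differential_comp_chart hq (LinearMap.toContinuousLinearMap α).differentiableAt
  rwa [ContinuousLinearMap.fderiv] at h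

lemma bracket_coordinate (c : TensorField F N) {x q : N} (hq : q ∈ (chartAt F x).source)
    (α β : Module.Dual ℝ F) :
    bracket c (fun y => α (chartAt F x y)) (fun y => β (chartAt F x y)) q =
      chartTensor c x (chartAt F x q) α β := by
  rw [bracket, differential_coordinate hq, differential_coordinate hq, chartTensor_chartAt c hq]
  rfl

lemma contDiffOn_chartTensor {c : TensorField F N} (hc : IsPoisson c) (x : N)
    (α β : Module.Dual ℝ F) :
    ContDiffOn ℝ ∞ (fun z => chartTensor c x z α β) (chartAt F x).target := by
  have hbracket := (hc.smooth _ (chartAt F x).open_source _ _ (smoothOn_coordinate x α)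
    (smoothOn_coordinate x β)).comp (contMDiffOn_chart_symm (I := 𝓘(ℝ, F)) (x := x))
    (fun z hz => (chartAt F x).map_target hz)
  refine hbracket.contDiffOn.congr fun z hz => ?_
  rw [Function.comp_apply, bracket_coordinate c ((chartAt F x).map_target hz),
    (chartAt F x).right_inv hz]

lemma bracket_coordinate_bracket {c : TensorField F N} (hc : IsPoisson c) {x q : N}
    (hq : q ∈ (chartAt F x).source) (α β γ : Module.Dual ℝ F) :
    bracket c (fun y => α (chartAt F x y))
        (bracket c (fun y => β (chartAt F x y)) (fun y => γ (chartAt F x y))) q =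
      chartTensor c x (chartAt F x q) α
        (fderiv ℝ (fun z => chartTensor c x z β γ) (chartAt F x q)).toLinearMap := by
  have hdiff : DifferentiableAt ℝ (fun z => chartTensor c x z β γ) (chartAt F x q) :=
    ((contDiffOn_chartTensor hc x β γ).contDiffAt ((chartAt F x).open_target.mem_nhds
      ((chartAt F x).map_source hq))).differentiableAt (by simp)
  have heq : bracket c (fun y => β (chartAt F x y)) (fun y => γ (chartAt F x y)) =ᶠ[𝓝 q]
      fun y => chartTensor c x (chartAt F x y) β γ := by
    filter_upwards [(chartAt F x).open_source.mem_nhds hq] with y hy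
    exact bracket_coordinate c hy β γ
  rw [bracket, differential_congr heq, differential_comp_chart hq hdiff,
    differential_coordinate hq, chartTensor_chartAt c hq]
  rfl

lemma chartTensor_jacobi {c : TensorField F N} (hc : IsPoisson c) {x : N} {z : F}
    (hz : z ∈ (chartAt F x).target) (α β γ : Module.Dual ℝ F) :
    chartTensor c x z α (fderiv ℝ (fun z => chartTensor c x z β γ) z).toLinearMap
      + chartTensor c x z β (fderiv ℝ (fun z => chartTensor c x z γ α) z).toLinearMap
      + chartTensor c x z γ (fderiv ℝ (fun z => chartTensor c x z α β) z).toLinearMap = 0 := by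
  have hq := (chartAt F x).map_target hz
  have hJ := hc.jacobi _ (chartAt F x).open_source _ _ _ (smoothOn_coordinate x α)
    (smoothOn_coordinate x β) (smoothOn_coordinate x γ) _ hq
  rwa [bracket_coordinate_bracket hc hq, bracket_coordinate_bracket hc hq,
    bracket_coordinate_bracket hc hq, (chartAt F x).right_inv hz] at hJ

lemma exists_casimir_chartTensor {c : TensorField F N} (hc : IsPoisson c) {x : N}
    (hrank : ∀ᶠ q in 𝓝 x, formRank (c q) = formRank (c x)) {l : F →L[ℝ] ℝ}
    (hl : chartTensor c x (chartAt F x x) l.toLinearMap = 0) :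
    ∃ G : F → ℝ, (∀ᶠ z in 𝓝 (chartAt F x x), ContDiffAt ℝ ∞ G z ∧
      chartTensor c x z (fderiv ℝ G z).toLinearMap = 0) ∧ fderiv ℝ G (chartAt F x x) = l := by
  have hx := mem_chart_source F x
  have htarget := (chartAt F x).open_target.mem_nhds ((chartAt F x).map_source hx)
  refine exists_casimir_vectorSpace (π := chartTensor c x) ?_
    (.of_forall fun z α => hc.alternating _ _) ?_ ?_ hl
  · filter_upwards [htarget] with z hz α β
    exact (contDiffOn_chartTensor hc x α β).contDiffAt ((chartAt F x).open_target.mem_nhds hz)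
  · filter_upwards [htarget] with z hz using chartTensor_jacobi hc hz
  · have hsymm := (chartAt F x).continuousAt_symm ((chartAt F x).map_source hx)
    rw [ContinuousAt, (chartAt F x).left_inv hx] at hsymm
    filter_upwards [htarget, hsymm.eventually hrank] with z hz hrankz
    rw [formRank_chartTensor c hz, hrankz, formRank_chartTensor c ((chartAt F x).map_source hx),
      (chartAt F x).left_inv hx]

theorem exists_casimir {c : TensorField F N} (hc : IsPoisson c) {x : N}
    (hrank : ∀ᶠ q in 𝓝 x, formRank (c q) = formRank (c x)) {ξ : Module.Dual ℝ F}
    (hξ : c x ξ = 0) :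
    ∃ U : Set N, IsOpen U ∧ x ∈ U ∧ ∃ f : N → ℝ, IsCasimirOn c U f ∧ differential f x = ξ := by
  have hx := mem_chart_source F x
  obtain ⟨l, rfl⟩ := dualMap_chartDifferential_surjective hx ξ
  obtain ⟨G, hG, hG₀⟩ := exists_casimir_chartTensor hc hrank
    (l := LinearMap.toContinuousLinearMap l) ((chartTensor_chartAt_apply_eq_zero_iff c hx _).2 hξ)
  obtain ⟨S, hS, hS_open, hxS⟩ := eventually_nhds_iff.1 hG
  have hGS : ContDiffOn ℝ ∞ G S := fun z hz => (hS z hz).1.contDiffWithinAt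
  refine ⟨(chartAt F x).source ∩ chartAt F x ⁻¹' S, (chartAt F x).isOpen_inter_preimage hS_open,
    ⟨hx, hxS⟩, fun y => G (chartAt F x y), ⟨?_, fun y hy => ?_⟩, ?_⟩
  · exact hGS.contMDiffOn.comp (contMDiffOn_chart.mono Set.inter_subset_left) fun y hy => hy.2
  · rw [differential_comp_chart hy.1 ((hS _ hy.2).1.differentiableAt (by simp)),
      ← chartTensor_chartAt_apply_eq_zero_iff c hy.1]
    exact (hS _ hy.2).2
  · rw [differential_comp_chart hx (hG.self_of_nhds.1.differentiableAt (by simp)), hG₀]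
    rfl

end PoissonManifold

/-! ### Pencils of constant rank -/

section Pencil

open Module

variable {K V W : Type*} [Field K] [AddCommGroup V] [Module K V]
  [AddCommGroup W] [Module K W]

/-- All nonzero members of the pencil spanned by `a` and `b` have the rank `R`. For the
complexifications of two Poisson bivectors this is completeness at a point. -/
def HasConstantRank (a b : V →ₗ[K] W) (R : ℕ) : Prop :=
  ∀ x y : K, (x ≠ 0 ∨ y ≠ 0) → finrank K (LinearMap.range (x • a + y • b)) = R

/-- The core of the pencil spanned by `a` and `b`: the span of the kernels of its nonzero
members. For the complexifications of two Poisson bivectors it is the span of the differentials of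
the first integrals. -/
def pencilCore (a b : V →ₗ[K] W) : Submodule K V :=
  ⨆ (x : K) (y : K) (_ : x ≠ 0 ∨ y ≠ 0), LinearMap.ker (x • a + y • b)

lemma ker_le_pencilCore (a b : V →ₗ[K] W) {x y : K} (hxy : x ≠ 0 ∨ y ≠ 0) :
    LinearMap.ker (x • a + y • b) ≤ pencilCore a b :=
  le_iSup_of_le x (le_iSup_of_le y (le_iSup_of_le hxy le_rfl))

variable {a b : V →ₗ[K] W} {R : ℕ}

lemma HasConstantRank.finrank_range_add_smul (h : HasConstantRank a b R) (t : K) :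
    finrank K (LinearMap.range (a + t • b)) = R := by
  have := h 1 t (Or.inl one_ne_zero)
  rwa [one_smul] at this

lemma HasConstantRank.finrank_range_right (h : HasConstantRank a b R) :
    finrank K (LinearMap.range b) = R := by
  have := h 0 1 (Or.inr one_ne_zero)
  rwa [zero_smul, one_smul, zero_add] at this

lemma HasConstantRank.symm (h : HasConstantRank a b R) : HasConstantRank b a R := fun x y hxy => by
  rw [add_comm]
  exact h y x hxy.symm

variable [FiniteDimensional K V]

lemma finite_setOf_not_injective_id_add_smul (C : End K V) :
    {t : K | ¬ Function.Injective ((LinearMap.id : End K V) + t • C)}.Finite := by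
  refine (C.finite_hasEigenvalue.preimage (f := fun t : K => -t⁻¹) fun s _ t _ hst =>
    inv_injective (neg_injective hst)).subset fun t ht => ?_
  rw [Set.mem_ofPred_eq, ← LinearMap.ker_eq_bot, Submodule.eq_bot_iff] at ht
  push Not at ht
  obtain ⟨v, hv, hv0⟩ := ht
  have hCv : t • C v = -v := eq_neg_of_add_eq_zero_right hv
  have ht0 : t ≠ 0 := by
    rintro rfl
    exact hv0 (by simpa using hCv.symm)
  refine Module.End.hasEigenvalue_of_hasEigenvector (x := v)
    ⟨Module.End.mem_eigenspace_iff.2 ?_, hv0⟩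
  rw [neg_smul, ← smul_neg, ← hCv, inv_smul_smul₀ ht0]

lemma finrank_range_le_of_infinite (A B : V →ₗ[K] W) {r : ℕ} {T : Set K} (hT : T.Infinite)
    (h : ∀ t ∈ T, finrank K (LinearMap.range (A + t • B)) ≤ r) :
    finrank K (LinearMap.range A) ≤ r := by
  obtain ⟨i, hi⟩ := A.rangeRestrict.exists_rightInverse_of_surjective A.range_rangeRestrict
  obtain ⟨j, hj⟩ := (LinearMap.range A).subtype.exists_leftInverse_of_injective
    (Submodule.ker_subtype _)
  have hA : j ∘ₗ A ∘ₗ i = LinearMap.id := calc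
    j ∘ₗ A ∘ₗ i = (j ∘ₗ (LinearMap.range A).subtype) ∘ₗ A.rangeRestrict ∘ₗ i := rfl
    _ = LinearMap.id := by rw [hi, hj, LinearMap.comp_id]
  obtain ⟨t, htT, ht⟩ :=
    hT.exists_notMem_finite (finite_setOf_not_injective_id_add_smul (j ∘ₗ B ∘ₗ i))
  have hinj : Function.Injective ((A + t • B) ∘ₗ i) := by
    have hcomp : j ∘ₗ (A + t • B) ∘ₗ i = LinearMap.id + t • (j ∘ₗ B ∘ₗ i) := by
      rw [← hA, LinearMap.add_comp, LinearMap.comp_add, LinearMap.smul_comp, LinearMap.comp_smul]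
    refine Function.Injective.of_comp (f := j) ?_
    rw [← LinearMap.coe_comp, hcomp]
    exact not_not.1 ht
  calc finrank K (LinearMap.range A)
      = finrank K (LinearMap.range ((A + t • B) ∘ₗ i)) :=
        (LinearMap.finrank_range_of_inj hinj).symm
    _ ≤ finrank K (LinearMap.range (A + t • B)) :=
        Submodule.finrank_mono (LinearMap.range_comp_le_range _ _)
    _ ≤ r := h t htT

lemma ker_le_iSup_ker_add_smul (A B : V →ₗ[K] W) {T : Set K} (hT : T.Infinite)
    (h : ∀ t ∈ T, finrank K (LinearMap.range (A + t • B)) ≤ finrank K (LinearMap.range A)) :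
    LinearMap.ker A ≤ ⨆ t ∈ T, LinearMap.ker (A + t • B) := by
  intro v hv
  by_contra hne
  obtain ⟨l, hlv, hl⟩ := Submodule.exists_le_ker_of_notMem hne
  -- Adjoining `l` to `A` raises its rank, but not that of the members with parameter in `T`.
  have hrank : finrank K (LinearMap.range (A.prod l)) ≤ finrank K (LinearMap.range A) := by
    refine finrank_range_le_of_infinite _ (B.prod 0) hT fun t ht => le_trans (le_of_eq ?_) (h t ht)
    have hprod : A.prod l + t • B.prod 0 = (A + t • B).prod l := by
      ext v <;> simp
    have hker : LinearMap.ker ((A + t • B).prod l) = LinearMap.ker (A + t • B) := by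
      rw [LinearMap.ker_prod, inf_eq_left.2 ((le_iSup₂_of_le t ht le_rfl).trans hl)]
    have := LinearMap.finrank_range_add_finrank_ker (A + t • B)
    have := LinearMap.finrank_range_add_finrank_ker ((A + t • B).prod l)
    rw [hker] at this
    rw [hprod]
    omega
  have := LinearMap.finrank_range_add_finrank_ker A
  have := LinearMap.finrank_range_add_finrank_ker (A.prod l)
  rw [LinearMap.ker_prod] at this
  have hker : LinearMap.ker A ⊓ LinearMap.ker l = LinearMap.ker A :=
    Submodule.eq_of_le_of_finrank_le inf_le_left (by omega)
  exact hlv (LinearMap.mem_ker.1 (inf_eq_left.1 hker hv))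

lemma finrank_map_add_finrank_ker (f : V →ₗ[K] W) {S : Submodule K V}
    (hS : LinearMap.ker f ≤ S) :
    finrank K (S.map f) + finrank K (LinearMap.ker f) = finrank K S := by
  have h := LinearMap.finrank_range_add_finrank_ker (f.domRestrict S)
  rwa [LinearMap.range_domRestrict, LinearMap.ker_domRestrict,
    (Submodule.comapSubtypeEquivOfLe hS).finrank_eq] at h

lemma HasConstantRank.ker_add_smul_le_iSup (h : HasConstantRank a b R) {T : Set K}
    (hT : T.Infinite) (s : K) :
    LinearMap.ker (a + s • b) ≤ ⨆ t ∈ T, LinearMap.ker (a + t • b) := by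
  have hadd (t : K) : a + s • b + t • b = a + (s + t) • b := by rw [add_smul, add_assoc]
  refine (ker_le_iSup_ker_add_smul (a + s • b) b (T := (s + ·) ⁻¹' T)
    (hT.preimage fun t _ => ⟨t - s, add_sub_cancel s t⟩) fun t _ => ?_).trans
      (iSup₂_le fun t ht => ?_)
  · rw [hadd, h.finrank_range_add_smul, h.finrank_range_add_smul]
  · rw [hadd]
    exact le_iSup₂_of_le (s + t) ht le_rfl

lemma HasConstantRank.ker_right_le_iSup (h : HasConstantRank a b R) {T : Set K}
    (hT : T.Infinite) : LinearMap.ker b ≤ ⨆ t ∈ T, LinearMap.ker (a + t • b) := by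
  refine (ker_le_iSup_ker_add_smul b a (T := Inv.inv ⁻¹' (T \ {0}))
    ((hT.sdiff (Set.finite_singleton 0)).preimage fun t _ => ⟨t⁻¹, inv_inv t⟩)
      fun t _ => ?_).trans (iSup₂_le fun t ⟨ht, ht0⟩ => le_iSup₂_of_le t⁻¹ ht ?_)
  · rw [h.symm.finrank_range_add_smul, h.finrank_range_right]
  · have ht0 : t ≠ 0 := fun h => ht0 (by simp [h])
    rw [← LinearMap.ker_smul (a + t⁻¹ • b) t ht0, smul_add, smul_inv_smul₀ ht0, add_comm]

lemma HasConstantRank.pencilCore_le_iSup (h : HasConstantRank a b R) {T : Set K}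
    (hT : T.Infinite) : pencilCore a b ≤ ⨆ t ∈ T, LinearMap.ker (a + t • b) := by
  refine iSup_le fun x => iSup₂_le fun y hxy => ?_
  by_cases hx : x = 0
  · rw [hx, zero_smul, zero_add, LinearMap.ker_smul _ _ (hxy.resolve_left (not_not.2 hx))]
    exact h.ker_right_le_iSup hT
  · have hfactor : x • a + y • b = x • (a + (x⁻¹ * y) • b) := by
      rw [smul_add, smul_smul, mul_inv_cancel_left₀ hx]
    rw [hfactor, LinearMap.ker_smul _ _ hx]
    exact h.ker_add_smul_le_iSup hT _

lemma HasConstantRank.map_right_pencilCore_le [Infinite K] (h : HasConstantRank a b R) :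
    (pencilCore a b).map b ≤ (pencilCore a b).map a := by
  rw [Submodule.map_le_iff_le_comap]
  refine (h.pencilCore_le_iSup (Set.finite_singleton 0).infinite_compl).trans
    (iSup₂_le fun t (ht : t ≠ 0) v hv => ⟨-t⁻¹ • v, Submodule.smul_mem _ _ ?_, ?_⟩)
  · simpa using ker_le_pencilCore a b (x := 1) (y := t) (Or.inl one_ne_zero) (by simpa using hv)
  · rw [map_smul, eq_neg_of_add_eq_zero_left hv, LinearMap.smul_apply, neg_smul_neg,
      inv_smul_smul₀ ht]

lemma HasConstantRank.map_pencilCore [Infinite K] (h : HasConstantRank a b R) {x y : K}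
    (hxy : x ≠ 0 ∨ y ≠ 0) :
    (pencilCore a b).map (x • a + y • b) = (pencilCore a b).map a := by
  have hle : (pencilCore a b).map (x • a + y • b) ≤ (pencilCore a b).map a := by
    rintro _ ⟨v, hv, rfl⟩
    exact add_mem (Submodule.smul_mem _ _ (Submodule.mem_map_of_mem hv))
      (Submodule.smul_mem _ _ (h.map_right_pencilCore_le (Submodule.mem_map_of_mem hv)))
  have hfinrank {x y : K} (hxy : x ≠ 0 ∨ y ≠ 0) :
      finrank K ((pencilCore a b).map (x • a + y • b)) + finrank K V =
        finrank K (pencilCore a b) + R := by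
    have := finrank_map_add_finrank_ker _ (ker_le_pencilCore a b hxy)
    have := LinearMap.finrank_range_add_finrank_ker (x • a + y • b)
    have := h x y hxy
    omega
  refine Submodule.eq_of_le_of_finrank_eq hle ?_
  have := hfinrank hxy
  have := hfinrank (x := 1) (y := 0) (Or.inl one_ne_zero)
  rw [one_smul, zero_smul, add_zero] at this
  omega

lemma exists_smul_add_smul_apply_eq_zero [IsAlgClosed K] [Nontrivial V] [FiniteDimensional K W]
    (hVW : finrank K V = finrank K W) (a b : V →ₗ[K] W) :
    ∃ x y : K, (x ≠ 0 ∨ y ≠ 0) ∧ ∃ v ≠ 0, (x • a + y • b) v = 0 := by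
  by_cases hb : Function.Injective b
  · let e : V ≃ₗ[K] W := LinearEquiv.ofInjectiveOfFinrankEq b hb hVW
    obtain ⟨μ, hμ⟩ := Module.End.exists_eigenvalue (e.symm.toLinearMap ∘ₗ a)
    obtain ⟨v, hv, hv0⟩ := hμ.exists_hasEigenvector
    have hav : a v = μ • b v := by
      have := Module.End.mem_eigenspace_iff.1 hv
      rwa [LinearMap.comp_apply, LinearEquiv.coe_coe, LinearEquiv.symm_apply_eq, map_smul] at this
    exact ⟨1, -μ, Or.inl one_ne_zero, v, hv0, by simp [hav]⟩
  · rw [← LinearMap.ker_eq_bot, Submodule.eq_bot_iff] at hb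
    push Not at hb
    obtain ⟨v, hv, hv0⟩ := hb
    exact ⟨0, 1, Or.inr one_ne_zero, v, hv0, by simpa using hv⟩

end Pencil

section AlternatingPencil

variable {K V : Type*} [Field K] [AddCommGroup V] [Module K V]

lemma orthogonal_eq_dualCoannihilator_map (B : LinearMap.BilinForm K V)
    (S : Submodule K V) : B.orthogonal S = (S.map B).dualCoannihilator := by
  ext v
  simp [Submodule.mem_dualCoannihilator, LinearMap.BilinForm.mem_orthogonal_iff]

lemma isAlt_smul_add_smul {a b : LinearMap.BilinForm K V} (ha : a.IsAlt) (hb : b.IsAlt) (x y : K) :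
    (x • a + y • b : LinearMap.BilinForm K V).IsAlt := fun v => by
  simp [ha.self_eq_zero, hb.self_eq_zero]

lemma apply_eq_zero_of_mem_ker_add_smul {a b : LinearMap.BilinForm K V} (ha : a.IsAlt)
    (hb : b.IsAlt) {s t : K} (hst : s ≠ t) {u v : V} (hu : u ∈ LinearMap.ker (a + s • b))
    (hv : v ∈ LinearMap.ker (a + t • b)) : a u v = 0 := by
  have hs : a u v + s * b u v = 0 := LinearMap.congr_fun hu v
  have ht : a v u + t * b v u = 0 := LinearMap.congr_fun hv u
  rw [← ha.neg_eq, ← hb.neg_eq] at ht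
  have hb0 : b u v = 0 := by
    refine (mul_eq_zero.1 ?_).resolve_left (sub_ne_zero.2 hst)
    linear_combination hs + ht
  simpa [hb0] using hs

variable [FiniteDimensional K V]

lemma orthogonal_orthogonal_of_ker_le {B : LinearMap.BilinForm K V} (hB : B.IsRefl)
    {S : Submodule K V} (hS : LinearMap.ker B ≤ S) : B.orthogonal (B.orthogonal S) = S := by
  refine (Submodule.eq_of_le_of_finrank_le
    (LinearMap.BilinForm.le_orthogonal_orthogonal hB) ?_).symm
  have hker : LinearMap.ker B ≤ B.orthogonal S := by
    rw [← LinearMap.BilinForm.orthogonal_top_eq_ker hB]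
    exact LinearMap.BilinForm.orthogonal_le le_top
  have h := LinearMap.BilinForm.finrank_add_finrank_orthogonal' (B := B) S
  have h' := LinearMap.BilinForm.finrank_add_finrank_orthogonal' (B := B) (B.orthogonal S)
  rw [inf_eq_right.2 hS] at h
  rw [inf_eq_right.2 hker] at h'
  omega

variable {a b : LinearMap.BilinForm K V} {R : ℕ}

lemma HasConstantRank.pencilCore_le_orthogonal [Infinite K] (h : HasConstantRank a b R)
    (ha : a.IsAlt) (hb : b.IsAlt) : pencilCore a b ≤ a.orthogonal (pencilCore a b) := by
  have hker {s : K} {u : V} (hu : u ∈ LinearMap.ker (a + s • b)) :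
      pencilCore a b ≤ LinearMap.ker (a u) :=
    (h.pencilCore_le_iSup (Set.finite_singleton s).infinite_compl).trans
      (iSup₂_le fun t ht _ hv => apply_eq_zero_of_mem_ker_add_smul ha hb (Ne.symm ht) hu hv)
  intro v hv
  have : pencilCore a b ≤ LinearMap.ker (a.flip v) :=
    (h.pencilCore_le_iSup Set.infinite_univ).trans (iSup₂_le fun _ _ _ hu => hker hu hv)
  exact fun u hu => this hu

lemma HasConstantRank.orthogonal_smul_add_smul_pencilCore [Infinite K]
    (h : HasConstantRank a b R) {x y : K} (hxy : x ≠ 0 ∨ y ≠ 0) :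
    (x • a + y • b : LinearMap.BilinForm K V).orthogonal (pencilCore a b) =
      a.orthogonal (pencilCore a b) := by
  rw [orthogonal_eq_dualCoannihilator_map, h.map_pencilCore hxy,
    ← orthogonal_eq_dualCoannihilator_map]

/-- On a complement of the core in its orthogonal, all nonzero members of the pencil would be
nondegenerate, which is impossible over an algebraically closed field. -/
theorem HasConstantRank.orthogonal_pencilCore [IsAlgClosed K] (h : HasConstantRank a b R)
    (ha : a.IsAlt) (hb : b.IsAlt) {x y : K} (hxy : x ≠ 0 ∨ y ≠ 0) :
    (x • a + y • b : LinearMap.BilinForm K V).orthogonal (pencilCore a b) = pencilCore a b := by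
  have : Infinite K := IsAlgClosed.instInfinite
  rw [h.orthogonal_smul_add_smul_pencilCore hxy]
  set Φ := pencilCore a b with hΦ
  have hΦ_le : Φ ≤ a.orthogonal Φ := h.pencilCore_le_orthogonal ha hb
  obtain ⟨C', hC'⟩ := Submodule.exists_isCompl Φ
  set C := C' ⊓ a.orthogonal Φ
  have hsup : Φ ⊔ C = a.orthogonal Φ := by
    rw [← sup_inf_assoc_of_le C' hΦ_le, hC'.sup_eq_top, top_inf_eq]
  suffices hC : C = ⊥ by rwa [hC, sup_bot_eq, eq_comm] at hsup
  by_contra hC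
  have : Nontrivial C := Submodule.nontrivial_iff_ne_bot.2 hC
  obtain ⟨x, y, hxy, v, hv0, hv⟩ := exists_smul_add_smul_apply_eq_zero
    (Subspace.dual_finrank_eq (K := K) (V := C)).symm (a.restrict C) (b.restrict C)
  have halt := isAlt_smul_add_smul ha hb x y
  have hvΦ : (v : V) ∈ Φ := by
    rw [hΦ, ← orthogonal_orthogonal_of_ker_le halt.isRefl (ker_le_pencilCore a b hxy),
      h.orthogonal_smul_add_smul_pencilCore hxy, ← hΦ, ← hsup]
    intro w hw
    obtain ⟨u, hu, w', hw', rfl⟩ := Submodule.mem_sup.1 hw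
    have huv : (x • a + y • b) u v = 0 := by
      have hvorth := v.2.2
      rw [← h.orthogonal_smul_add_smul_pencilCore hxy] at hvorth
      exact hvorth u hu
    have hwv : (x • a + y • b) w' v = 0 :=
      halt.isRefl _ _ (LinearMap.congr_fun hv ⟨w', hw'⟩)
    rw [map_add, LinearMap.add_apply, huv, hwv, add_zero]
  exact hv0 (Subtype.ext (Submodule.disjoint_def.1 hC'.disjoint _ hvΦ v.2.1))

end AlternatingPencil

/-! ### Complexified bilinear forms -/

section BaseChange

open Module TensorProduct

section CommRing

variable {K : Type*} (L : Type*) [CommRing K] [CommRing L] [Algebra K L]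
  {W : Type*} [AddCommGroup W] [Module K W]

variable {L} in
lemma bilinForm_baseChange_ext {B B' : LinearMap.BilinForm L (L ⊗[K] W)}
    (h : ∀ α β : W, B (1 ⊗ₜ α) (1 ⊗ₜ β) = B' (1 ⊗ₜ α) (1 ⊗ₜ β)) : B = B' := by
  ext α β
  exact h α β

lemma bilinForm_baseChange_one_tmul (B : LinearMap.BilinForm K W) (α β : W) :
    B.baseChange L (1 ⊗ₜ α) (1 ⊗ₜ β) = algebraMap K L (B α β) := by
  simp [Algebra.algebraMap_eq_smul_one]

lemma bilinForm_baseChange_smul_add_smul (r s : K) (A B : LinearMap.BilinForm K W) :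
    (r • A + s • B).baseChange L =
      algebraMap K L r • A.baseChange L + algebraMap K L s • B.baseChange L := by
  refine bilinForm_baseChange_ext fun α β => ?_
  simp only [LinearMap.add_apply, LinearMap.smul_apply, bilinForm_baseChange_one_tmul, smul_eq_mul,
    map_add, map_mul]

lemma isAlt_baseChange {B : LinearMap.BilinForm K W} (hB : B.IsAlt) : (B.baseChange L).IsAlt := by
  have hflip : LinearMap.flip (B.baseChange L) = -B.baseChange L := by
    refine bilinForm_baseChange_ext fun α β => ?_
    rw [LinearMap.flip_apply, LinearMap.neg_apply, LinearMap.neg_apply,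
      bilinForm_baseChange_one_tmul, bilinForm_baseChange_one_tmul, ← hB.neg_eq, map_neg]
  intro u
  induction u with
  | zero => simp
  | tmul z α => simp [hB.self_eq_zero]
  | add u v hu hv =>
    have huv : B.baseChange L v u = -B.baseChange L u v := LinearMap.congr_fun₂ hflip u v
    rw [map_add, map_add, LinearMap.add_apply, LinearMap.add_apply, hu, hv, huv]
    abel

end CommRing

variable {K : Type*} (L : Type*) [Field K] [Field L] [Algebra K L]
  {W : Type*} [AddCommGroup W] [Module K W]

lemma finrank_submodule_baseChange (p : Submodule K W) :
    finrank L (p.baseChange L) = finrank K p := by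
  have hinj : Function.Injective (p.subtype.baseChange L) :=
    Module.Flat.lTensor_preserves_injective_linearMap (M := L) p.subtype p.injective_subtype
  exact (LinearMap.finrank_range_of_inj hinj).trans finrank_baseChange

variable [FiniteDimensional K W]

lemma ker_bilinForm_baseChange (B : LinearMap.BilinForm K W) :
    LinearMap.ker (B.baseChange L) = (LinearMap.ker B).baseChange L := by
  let e := (TensorProduct.isBaseChange K W L).toDualBaseChange
  have h : B.baseChange L = e.toLinearMap ∘ₗ LinearMap.baseChange L B := by
    refine bilinForm_baseChange_ext fun α β => ?_
    rw [bilinForm_baseChange_one_tmul, LinearMap.comp_apply, LinearMap.baseChange_tmul]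
    exact ((IsBaseChange.toDualBaseChange_tmul _ 1 (B α) β).trans (one_mul _)).symm
  rw [h, LinearEquiv.ker_comp]
  exact Module.Flat.ker_lTensor_eq ..

lemma formRank_baseChange (B : LinearMap.BilinForm K W) :
    formRank (B.baseChange L) = formRank B := by
  have h1 := LinearMap.finrank_range_add_finrank_ker B
  have h2 := LinearMap.finrank_range_add_finrank_ker (B.baseChange L)
  rw [ker_bilinForm_baseChange, finrank_submodule_baseChange, finrank_baseChange] at h2
  rw [formRank, formRank]
  omega

end BaseChange

section Complexification

open TensorProduct

variable {W : Type*} [AddCommGroup W] [Module ℝ W]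

lemma exists_eq_one_tmul_add_I_smul (u : ℂ ⊗[ℝ] W) :
    ∃ α β : W, u = (1 : ℂ) ⊗ₜ[ℝ] α + Complex.I • ((1 : ℂ) ⊗ₜ[ℝ] β) := by
  induction u with
  | zero => exact ⟨0, 0, by simp⟩
  | tmul z α =>
    refine ⟨z.re • α, z.im • α, ?_⟩
    rw [TensorProduct.smul_tmul', ← TensorProduct.smul_tmul, ← TensorProduct.smul_tmul,
      ← TensorProduct.add_tmul]
    congr 1
    rw [Complex.real_smul, Complex.real_smul, smul_eq_mul, mul_one, mul_one,
      Complex.re_add_im]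
  | add u v hu hv =>
    obtain ⟨α, β, rfl⟩ := hu
    obtain ⟨α', β', rfl⟩ := hv
    refine ⟨α + α', β + β', ?_⟩
    rw [tmul_add, tmul_add, smul_add]
    abel

lemma bilinForm_baseChange_add_I_smul (x y x' y' : ℝ) (A B : LinearMap.BilinForm ℝ W) :
    (x • A + y • B).baseChange ℂ + Complex.I • (x' • A + y' • B).baseChange ℂ =
      (⟨x, x'⟩ : ℂ) • A.baseChange ℂ + (⟨y, y'⟩ : ℂ) • B.baseChange ℂ := by
  refine bilinForm_baseChange_ext fun α β => ?_
  simp only [LinearMap.add_apply, LinearMap.smul_apply, bilinForm_baseChange_one_tmul, smul_eq_mul,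
    Complex.coe_algebraMap]
  apply Complex.ext <;> simp

end Complexification

section Semicontinuity

open Module TensorProduct

lemma continuousOn_bilinForm_baseChange {K L W Z : Type*} [CommRing K] [CommRing L] [Algebra K L]
    [TopologicalSpace L] [IsTopologicalRing L] [AddCommGroup W] [Module K W] [TopologicalSpace Z]
    {B : Z → LinearMap.BilinForm L (L ⊗[K] W)} {S : Set Z}
    (h : ∀ α β : W, ContinuousOn (fun z => B z (1 ⊗ₜ α) (1 ⊗ₜ β)) S) (u v : L ⊗[K] W) :
    ContinuousOn (fun z => B z u v) S := by
  induction u with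
  | zero => simpa only [map_zero, LinearMap.zero_apply] using continuousOn_const
  | add u u' hu hu' => simpa only [map_add, LinearMap.add_apply] using hu.fun_add hu'
  | tmul a α =>
    induction v with
    | zero => simpa only [map_zero] using continuousOn_const
    | add v v' hv hv' => simpa only [map_add] using hv.fun_add hv'
    | tmul b β =>
      have hsmul (z : Z) :
          B z (a ⊗ₜ α) (b ⊗ₜ β) = a * (b * B z (1 ⊗ₜ α) (1 ⊗ₜ β)) := by
        rw [← mul_one a, ← mul_one b, ← smul_eq_mul, ← smul_eq_mul, ← TensorProduct.smul_tmul',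
          ← TensorProduct.smul_tmul', map_smul, map_smul, LinearMap.smul_apply, smul_eq_mul,
          smul_eq_mul, smul_eq_mul, smul_eq_mul, mul_one, mul_one, mul_left_comm]
      simp only [hsmul]
      exact continuousOn_const.mul (continuousOn_const.mul (h α β))

lemma lowerSemicontinuousOn_formRank {𝕜 Z U : Type*} [NontriviallyNormedField 𝕜] [CompleteSpace 𝕜]
    [TopologicalSpace Z] [AddCommGroup U] [Module 𝕜 U] [FiniteDimensional 𝕜 U]
    {B : Z → LinearMap.BilinForm 𝕜 U} {S : Set Z}
    (hB : ∀ u v, ContinuousOn (fun z => B z u v) S) :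
    LowerSemicontinuousOn (fun z => formRank (B z)) S := by
  let b := finBasis 𝕜 U
  let L (z : Z) : (Fin (finrank 𝕜 U) → 𝕜) →L[𝕜] (Fin (finrank 𝕜 U) → 𝕜) :=
    LinearMap.toContinuousLinearMap
      (b.dualBasis.equivFun.toLinearMap ∘ₗ B z ∘ₗ b.equivFun.symm.toLinearMap)
  have hL : ContinuousOn L S :=
    continuousOn_clm_apply.2 fun v => continuousOn_pi.2 fun i =>
      (hB (b.equivFun.symm v) (b i)).congr fun z _ => b.dualBasis_equivFun _ i
  have hrank (z : Z) : (L z).toLinearMap.rank = formRank (B z) := by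
    have hLz : (L z).toLinearMap =
      b.dualBasis.equivFun.toLinearMap ∘ₗ B z ∘ₗ b.equivFun.symm.toLinearMap := rfl
    rw [LinearMap.rank, ← finrank_eq_rank, hLz, LinearMap.range_comp,
      LinearMap.range_comp_of_range_eq_top _ (LinearEquiv.range _), LinearEquiv.finrank_map_eq,
      formRank]
  intro z hz k hk
  have hmem : ((k + 1 : ℕ) : Cardinal) ≤ (L z).toLinearMap.rank := by
    rw [hrank]
    exact_mod_cast hk
  filter_upwards [(hL z hz).eventually ((isOpen_setOfPred_nat_le_rank (k + 1)).mem_nhds hmem)]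
    with y hy
  rw [hrank] at hy
  exact_mod_cast hy

end Semicontinuity

section SymplecticLinear

open Module

variable {K V U : Type*} [Field K] [AddCommGroup V] [Module K V] [AddCommGroup U] [Module K U]
  {B : LinearMap.BilinForm K V}

lemma ker_restrict_eq_comap_orthogonal (hrefl : B.IsRefl) (R : Submodule K V) :
    LinearMap.ker (B.restrict R) = (B.orthogonal R).comap R.subtype := by
  ext v
  refine ⟨fun hv w hw => hrefl _ _ (LinearMap.congr_fun hv ⟨w, hw⟩), fun hv => ?_⟩
  exact LinearMap.ext fun w => hrefl _ _ (hv w w.2)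

variable [FiniteDimensional K V]

/-- Whatever is orthogonal to `range f` lies in `range f`, hence in the image of the self-orthogonal
`Φ`; taking orthogonals back, the orthogonal of `Φ.map f` lies in `range f` too. -/
lemma orthogonal_map_eq (hB : B.Nondegenerate) (hrefl : B.IsRefl) {f : U →ₗ[K] V}
    (hf : B.orthogonal (LinearMap.range f) ≤ LinearMap.range f) {Φ : Submodule K U}
    (hΦ : LinearMap.BilinForm.orthogonal (B.compl₁₂ f f) Φ = Φ) :
    B.orthogonal (Φ.map f) = Φ.map f := by
  have hmem (u : U) : u ∈ Φ ↔ ∀ w ∈ Φ, B (f w) (f u) = 0 := by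
    conv_lhs => rw [← hΦ]
    rfl
  have hle : B.orthogonal (LinearMap.range f) ≤ Φ.map f := by
    intro w hw
    obtain ⟨u, rfl⟩ := hf hw
    exact ⟨u, (hmem u).2 fun k _ => hw _ ⟨k, rfl⟩, rfl⟩
  apply le_antisymm
  · intro v hv
    have hv' : v ∈ B.orthogonal (B.orthogonal (LinearMap.range f)) :=
      LinearMap.BilinForm.orthogonal_le hle hv
    rw [LinearMap.BilinForm.orthogonal_orthogonal hB hrefl] at hv'
    obtain ⟨u, rfl⟩ := hv'
    exact ⟨u, (hmem u).2 fun w hw => hv _ ⟨w, hw, rfl⟩, rfl⟩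
  · rintro _ ⟨u, hu, rfl⟩ _ ⟨w, hw, rfl⟩
    exact (hmem u).1 hu w hw

lemma formRank_restrict_add_finrank_inf_orthogonal (hrefl : B.IsRefl) (R : Submodule K V) :
    formRank (B.restrict R) + finrank K (R ⊓ B.orthogonal R : Submodule K V) = finrank K R := by
  rw [formRank, ← LinearMap.finrank_range_add_finrank_ker (B.restrict R),
    ker_restrict_eq_comap_orthogonal hrefl, ← Submodule.map_comap_subtype]
  exact congrArg _ (Submodule.equivSubtypeMap R _).finrank_eq.symm

lemma orthogonal_le_iff_formRank_restrict_le (hB : B.Nondegenerate) (hrefl : B.IsRefl)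
    (R : Submodule K V) :
    B.orthogonal R ≤ R ↔ formRank (B.restrict R) + finrank K V ≤ 2 * finrank K R := by
  have hrestrict := formRank_restrict_add_finrank_inf_orthogonal hrefl R
  have horthogonal := LinearMap.BilinForm.finrank_orthogonal hB R
  have hR : finrank K R ≤ finrank K V := Submodule.finrank_le R
  constructor
  · intro h
    rw [inf_eq_right.2 h] at hrestrict
    omega
  · intro h
    exact inf_eq_right.1 (Submodule.eq_of_le_of_finrank_le inf_le_right (by omega))

lemma orthogonal_range_le_iff_formRank_le (hB : B.Nondegenerate) (hrefl : B.IsRefl)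
    (f : U →ₗ[K] V) :
    B.orthogonal (LinearMap.range f) ≤ LinearMap.range f ↔
      formRank (B.compl₁₂ f f : LinearMap.BilinForm K U) + finrank K V ≤
        2 * finrank K (LinearMap.range f) := by
  have h : (B.compl₁₂ f f : LinearMap.BilinForm K U) =
      (B.restrict (LinearMap.range f)).compl₁₂ f.rangeRestrict f.rangeRestrict := rfl
  rw [orthogonal_le_iff_formRank_restrict_le hB hrefl, h,
    formRank_compl₁₂ _ f.surjective_rangeRestrict]

end SymplecticLinear

/-! ### The Hamiltonian lift of covectors -/

section CRLinear

open Module TensorProduct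

variable {E : Type*} [NormedAddCommGroup E] [NormedSpace ℂ E]

lemma isAlt_toBilin (η : E [⋀^Fin 2]→L[ℂ] ℂ) : (toBilin η).IsAlt := fun v =>
  η.map_eq_zero_of_eq ![v, v] (i := 0) (j := 1) rfl (by simp)

lemma covectorOneZero_apply (α : Dual ℝ E) (v : E) :
    covectorOneZero α v = (1 / 2 : ℂ) * ((α v : ℂ) - Complex.I * α (Complex.I • v)) := by
  rw [covectorOneZero, LinearMap.smul_apply, Dual.extendRCLikeₗ_apply, Dual.extendRCLike_apply]
  rfl

lemma covectorOneZero_apply_eq_zero_iff (α : Dual ℝ E) (v : E) :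
    covectorOneZero α v = 0 ↔ α v = 0 ∧ α (Complex.I • v) = 0 := by
  rw [covectorOneZero_apply, mul_eq_zero, or_iff_right (by norm_num), Complex.ext_iff]
  simp

lemma apply_eq_neg_apply_I_smul {α β : Dual ℝ E}
    (h : covectorOneZero α + Complex.I • covectorOneZero β = 0) (v : E) :
    α v = -β (Complex.I • v) := by
  have hre := congrArg Complex.re (LinearMap.congr_fun h v)
  rw [LinearMap.add_apply, LinearMap.smul_apply, covectorOneZero_apply, covectorOneZero_apply]
    at hre
  simp only [smul_eq_mul, Complex.add_re, Complex.mul_re, Complex.sub_re, Complex.sub_im,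
    Complex.mul_im, Complex.ofReal_re, Complex.ofReal_im, Complex.I_re, Complex.I_im,
    LinearMap.zero_apply, Complex.zero_re] at hre
  norm_num at hre
  linarith

lemma eq_zero_of_covectorOneZero_add_I_smul_eq_zero {D : Submodule ℝ E}
    (hD : D ⊔ D.map (complexStructure E) = ⊤) {α β : Dual ℝ E} (hα : D ≤ LinearMap.ker α)
    (hβ : D ≤ LinearMap.ker β) (h : covectorOneZero α + Complex.I • covectorOneZero β = 0) :
    α = 0 ∧ β = 0 := by
  have hβ0 : β = 0 := by
    rw [← LinearMap.ker_eq_top, eq_top_iff, ← hD, sup_le_iff, Submodule.map_le_iff_le_comap]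
    refine ⟨hβ, fun v hv => ?_⟩
    rw [Submodule.mem_comap, LinearMap.mem_ker]
    exact (zero_eq_neg.1 ((hα hv).symm.trans (apply_eq_neg_apply_I_smul h v)))
  refine ⟨LinearMap.ext fun v => ?_, hβ0⟩
  rw [apply_eq_neg_apply_I_smul h, hβ0, LinearMap.zero_apply, LinearMap.zero_apply, neg_zero]

lemma mem_crSubspace_iff (D : Submodule ℝ E) (v : E) :
    v ∈ crSubspace D ↔ v ∈ D ∧ Complex.I • v ∈ D := by
  constructor
  · rintro ⟨hv, w, hw, rfl⟩
    refine ⟨hv, ?_⟩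
    have hI : Complex.I • complexStructure E w = -w := by
      simp [complexStructure, smul_smul]
    rw [hI]
    exact D.neg_mem hw
  · rintro ⟨hv, hIv⟩
    refine ⟨hv, -(Complex.I • v), D.neg_mem hIv, ?_⟩
    simp [complexStructure, smul_smul]

lemma crSubspace_mono {D₁ D₂ : Submodule ℝ E} (h : D₁ ≤ D₂) : crSubspace D₁ ≤ crSubspace D₂ :=
  fun _ hv => ⟨h hv.1, Submodule.map_mono h hv.2⟩

variable [FiniteDimensional ℂ E] {M : Type*} [TopologicalSpace M] [ChartedSpace E M]
  (Ω : HolomorphicSymplecticForm E M) (x : M)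

lemma toBilin_sharp (ξ : Dual ℂ E) (v : E) : toBilin (Ω.toFun x) (sharp Ω x ξ) v = ξ v :=
  LinearMap.BilinForm.apply_toDual_symm_apply (hB := Ω.nondegenerate x) ξ v

section Lift

variable {E' : Type*} [AddCommGroup E'] [Module ℝ E'] (d : E →ₗ[ℝ] E')

/-- The Hamiltonian vector at `x` of the `(1,0)`-part of the pull-back by `d` of a real covector.
The map `d` stands for the differential at `x` of the projection of a realization. -/
def hamiltonianLift : Dual ℝ E' →ₗ[ℝ] E where
  toFun α := sharp Ω x (covectorOneZero (α ∘ₗ d))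
  map_add' α β := by
    rw [LinearMap.add_comp, covectorOneZero_add, map_add]
  map_smul' r α := by
    rw [LinearMap.smul_comp, covectorOneZero_smul, map_smul]
    exact Complex.coe_smul r _

/-- The complex linear extension of `hamiltonianLift`; it relates the complexified cotangent space
of the base of a realization to the holomorphic tangent space of its total space. -/
def complexHamiltonianLift : ℂ ⊗[ℝ] Dual ℝ E' →ₗ[ℂ] E :=
  (hamiltonianLift Ω x d).liftBaseChange ℂ

lemma complexHamiltonianLift_one_tmul (α : Dual ℝ E') :
    complexHamiltonianLift Ω x d (1 ⊗ₜ α) = sharp Ω x (covectorOneZero (α ∘ₗ d)) := by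
  rw [complexHamiltonianLift, LinearMap.liftBaseChange_tmul, one_smul]
  rfl

lemma toBilin_complexHamiltonianLift_one_tmul_eq_zero_iff (α : Dual ℝ E') (v : E) :
    toBilin (Ω.toFun x) (complexHamiltonianLift Ω x d (1 ⊗ₜ α)) v = 0 ↔
      α (d v) = 0 ∧ α (d (Complex.I • v)) = 0 := by
  rw [complexHamiltonianLift_one_tmul, toBilin_sharp, covectorOneZero_apply_eq_zero_iff]
  rfl

lemma crSubspace_comap_eq_orthogonal (D : Submodule ℝ E') :
    crSubspace (D.comap d) = (toBilin (Ω.toFun x)).orthogonal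
      ((D.dualAnnihilator.baseChange ℂ).map (complexHamiltonianLift Ω x d)) := by
  ext v
  have hD (w : E) : w ∈ D.comap d ↔ ∀ α ∈ D.dualAnnihilator, α (d w) = 0 :=
    (Subspace.forall_mem_dualAnnihilator_apply_eq_zero_iff D _).symm
  have hzero := toBilin_complexHamiltonianLift_one_tmul_eq_zero_iff Ω x d
  rw [mem_crSubspace_iff, hD, hD]
  constructor
  · rintro ⟨hv, hIv⟩ w hw
    rw [Submodule.baseChange_eq_span, Submodule.map_span] at hw
    refine (Submodule.span_le (p := LinearMap.ker ((toBilin (Ω.toFun x)).flip v))).2 ?_ hw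
    rintro _ ⟨_, ⟨α, hα, rfl⟩, rfl⟩
    exact (hzero α v).2 ⟨hv α hα, hIv α hα⟩
  · intro h
    have hα (α) (hα : α ∈ D.dualAnnihilator) := (hzero α v).1
      (h _ ⟨_, Submodule.tmul_mem_baseChange_of_mem 1 hα, rfl⟩)
    exact ⟨fun α hα' => (hα α hα').1, fun α hα' => (hα α hα').2⟩

lemma crSubspace_ker_eq_orthogonal :
    crSubspace (LinearMap.ker d) =
      (toBilin (Ω.toFun x)).orthogonal (LinearMap.range (complexHamiltonianLift Ω x d)) := by
  have h := crSubspace_comap_eq_orthogonal Ω x d ⊥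
  rwa [Submodule.dualAnnihilator_bot, Submodule.baseChange_top, Submodule.map_top] at h

lemma crSubspace_ker_le_orthogonal_iff :
    crSubspace (LinearMap.ker d) ≤
      (toBilin (Ω.toFun x)).orthogonal (crSubspace (LinearMap.ker d)) ↔
    (toBilin (Ω.toFun x)).orthogonal (LinearMap.range (complexHamiltonianLift Ω x d)) ≤
      LinearMap.range (complexHamiltonianLift Ω x d) := by
  rw [crSubspace_ker_eq_orthogonal Ω, LinearMap.BilinForm.orthogonal_orthogonal
    (Ω.nondegenerate x) (isAlt_toBilin _).isRefl]

variable {d}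

lemma complexHamiltonianLift_injective (hd : Function.Surjective d)
    (hgeneric : LinearMap.ker d ⊔ (LinearMap.ker d).map (complexStructure E) = ⊤) :
    Function.Injective (complexHamiltonianLift Ω x d) := by
  rw [← LinearMap.ker_eq_bot, LinearMap.ker_eq_bot']
  intro u hu
  obtain ⟨α, β, rfl⟩ := exists_eq_one_tmul_add_I_smul u
  rw [map_add, map_smul, complexHamiltonianLift_one_tmul, complexHamiltonianLift_one_tmul,
    ← map_smul, ← map_add, LinearEquiv.map_eq_zero_iff] at hu
  obtain ⟨hα, hβ⟩ := eq_zero_of_covectorOneZero_add_I_smul_eq_zero hgeneric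
    (LinearMap.ker_le_ker_comp d α) (LinearMap.ker_le_ker_comp d β) hu
  rw [LinearMap.dualMap_injective_of_surjective hd (hα.trans (map_zero d.dualMap).symm),
    LinearMap.dualMap_injective_of_surjective hd (hβ.trans (map_zero d.dualMap).symm),
    tmul_zero, smul_zero, add_zero]

end Lift

variable {Ω x} {E' : Type*} [NormedAddCommGroup E'] [NormedSpace ℝ E']
  {M' : Type*} [TopologicalSpace M'] [ChartedSpace E' M'] {p : M → M'} {c₁ c₂ : TensorField E' M'}

lemma toBilin_complexHamiltonianLift_eq_complexValue (h₁ : IsPushforward p (reBivector Ω) c₁)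
    (h₂ : IsPushforward p (imBivector Ω) c₂) :
    (toBilin (Ω.toFun x)).compl₁₂ (complexHamiltonianLift Ω x (realDifferential E E' p x))
      (complexHamiltonianLift Ω x (realDifferential E E' p x)) = complexValue c₁ c₂ (p x) := by
  refine bilinForm_baseChange_ext fun α β => ?_
  rw [LinearMap.compl₁₂_apply, complexHamiltonianLift_one_tmul, complexHamiltonianLift_one_tmul,
    complexValue, LinearMap.add_apply, LinearMap.smul_apply, LinearMap.add_apply,
    LinearMap.smul_apply, bilinForm_baseChange_one_tmul, bilinForm_baseChange_one_tmul, h₁, h₂,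
    smul_eq_mul, mul_comm]
  exact (Complex.re_add_im (inverseBivector Ω x _ _)).symm

lemma crSubspace_fibreTangent_le_orthogonal_iff_formRank_le [FiniteDimensional ℝ E']
    (hp : Function.Surjective (realDifferential E E' p x))
    (hgeneric : fibreTangent E E' p x ⊔ (fibreTangent E E' p x).map (complexStructure E) = ⊤)
    (h₁ : IsPushforward p (reBivector Ω) c₁) (h₂ : IsPushforward p (imBivector Ω) c₂) :
    crSubspace (fibreTangent E E' p x) ≤
      (toBilin (Ω.toFun x)).orthogonal (crSubspace (fibreTangent E E' p x)) ↔
    formRank (complexValue c₁ c₂ (p x)) + finrank ℂ E ≤ 2 * finrank ℝ E' := by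
  rw [fibreTangent, crSubspace_ker_le_orthogonal_iff,
    orthogonal_range_le_iff_formRank_le (Ω.nondegenerate x) (isAlt_toBilin _).isRefl,
    toBilin_complexHamiltonianLift_eq_complexValue h₁ h₂,
    LinearMap.finrank_range_of_inj (complexHamiltonianLift_injective Ω x hp hgeneric),
    finrank_baseChange, Subspace.dual_finrank_eq]

end CRLinear

/-! ### The bilagrangian foliation -/

section CompleteStructures

open Module TensorProduct

variable {F : Type*} [NormedAddCommGroup F] [NormedSpace ℝ F]
  {N : Type*}

lemma complexValue_one_tmul (c₁ c₂ : TensorField F N) (q : N) (α β : Dual ℝ F) :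
    complexValue c₁ c₂ q (1 ⊗ₜ α) (1 ⊗ₜ β) = (c₁ q α β : ℂ) + Complex.I * (c₂ q α β : ℂ) := by
  rw [complexValue, LinearMap.add_apply, LinearMap.add_apply, LinearMap.smul_apply,
    LinearMap.smul_apply, bilinForm_baseChange_one_tmul, bilinForm_baseChange_one_tmul]
  rfl

lemma complexValue_smul_add_smul (c₁ c₂ : TensorField F N) (s t : ℂ) (q : N) :
    complexValue (s.re • c₁ + t.re • c₂) (s.im • c₁ + t.im • c₂) q =
      s • (c₁ q).baseChange ℂ + t • (c₂ q).baseChange ℂ :=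
  bilinForm_baseChange_add_I_smul s.re t.re s.im t.im (c₁ q) (c₂ q)

lemma fieldRank_zero : fieldRank (0 : TensorField F N) = 0 := by
  refine Nat.le_zero.1 (ciSup_le' fun q => ?_)
  rw [formRank, Pi.zero_apply, LinearMap.range_zero, finrank_bot]

lemma maxRank_bot : maxRank (⊥ : Submodule ℝ (TensorField F N)) = 0 :=
  Nat.le_zero.1 (ciSup_le' fun c => by rw [(Submodule.mem_bot ℝ).1 c.2, fieldRank_zero])

section Rank

variable [FiniteDimensional ℝ F]

lemma formRank_le_fieldRank (c : TensorField F N) (q : N) : formRank (c q) ≤ fieldRank c := by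
  refine le_ciSup (f := fun q => formRank (c q)) ⟨finrank ℝ (Dual ℝ F), ?_⟩ q
  rintro _ ⟨q, rfl⟩
  exact LinearMap.finrank_range_le (c q)

lemma fieldRank_le_maxRank {J : Submodule ℝ (TensorField F N)} {c : TensorField F N}
    (hc : c ∈ J) : fieldRank c ≤ maxRank J := by
  refine le_ciSup (f := fun c : J => fieldRank (c : TensorField F N))
    ⟨finrank ℝ (Dual ℝ F), ?_⟩ ⟨c, hc⟩
  rintro _ ⟨c, rfl⟩
  exact ciSup_le' fun q => LinearMap.finrank_range_le _

end Rank

/- `V` is a monoid to match the instance found for `TensorField`; unifying with the additive group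
structure of `TensorField` times out. -/
lemma eq_zero_of_smul_add_smul_eq_zero_of_finrank_span {K V : Type*} [DivisionRing K]
    [AddCommMonoid V] [Module K V] {v w : V} (h : finrank K (Submodule.span K {v, w}) = 2)
    {s t : K} (hst : s • v + t • w = 0) : s = 0 ∧ t = 0 := by
  let _ : AddCommGroup V := Module.addCommMonoidToAddCommGroup K
  have hind : LinearIndependent K ![v, w] := by
    rw [linearIndependent_iff_card_eq_finrank_span, Fintype.card_fin, Set.finrank,
      Matrix.range_cons_cons_empty, h]
  exact LinearIndependent.pair_iff.1 hind s t hst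

variable {J : Submodule ℝ (TensorField F N)} {c₁ c₂ : TensorField F N} {x : N}

lemma CompleteAt.hasConstantRank [TopologicalSpace N] [ChartedSpace F N]
    (hx : CompleteAt J x) (hJ : IsBihamiltonian J) (hspan : J = Submodule.span ℝ {c₁, c₂}) :
    HasConstantRank ((c₁ x).baseChange ℂ) ((c₂ x).baseChange ℂ) (maxRank J) := by
  intro s t hst
  rcases hJ.dim with hdim | rfl
  · have hmem (a b : ℝ) : a • c₁ + b • c₂ ∈ J := by
      rw [hspan]
      exact Submodule.mem_span_pair.2 ⟨a, b, rfl⟩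
    rw [← complexValue_smul_add_smul]
    refine hx _ (hmem _ _) _ (hmem _ _) ?_
    by_contra! h
    rw [hspan] at hdim
    obtain ⟨hs_re, ht_re⟩ := eq_zero_of_smul_add_smul_eq_zero_of_finrank_span hdim h.1
    obtain ⟨hs_im, ht_im⟩ := eq_zero_of_smul_add_smul_eq_zero_of_finrank_span hdim h.2
    exact hst.elim (fun hs => hs (Complex.ext hs_re hs_im)) fun ht => ht (Complex.ext ht_re ht_im)
  · obtain ⟨rfl, rfl⟩ : c₁ = 0 ∧ c₂ = 0 := by
      simpa [Set.pair_subset_iff] using Submodule.span_eq_bot.1 hspan.symm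
    have hzero : ((0 : TensorField F N) x).baseChange ℂ = 0 :=
      bilinForm_baseChange_ext fun α β => by rw [bilinForm_baseChange_one_tmul]; simp
    rw [hzero, smul_zero, smul_zero, add_zero, LinearMap.range_zero, finrank_bot, maxRank_bot]

lemma baseChange_ker_le_pencilCore [FiniteDimensional ℝ F] {R : ℕ} {c : TensorField F N}
    (hR : HasConstantRank ((c₁ x).baseChange ℂ) ((c₂ x).baseChange ℂ) R)
    (hc : c ∈ Submodule.span ℝ {c₁, c₂}) (hmax : fieldRank c = R) :
    (LinearMap.ker (c x)).baseChange ℂ ≤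
      pencilCore ((c₁ x).baseChange ℂ) ((c₂ x).baseChange ℂ) := by
  obtain ⟨s, t, rfl⟩ := Submodule.mem_span_pair.1 hc
  by_cases hst : (s : ℂ) ≠ 0 ∨ (t : ℂ) ≠ 0
  · rw [← ker_bilinForm_baseChange, Pi.add_apply, Pi.smul_apply, Pi.smul_apply,
      bilinForm_baseChange_smul_add_smul]
    exact ker_le_pencilCore _ _ hst
  · obtain ⟨rfl, rfl⟩ : s = 0 ∧ t = 0 := by simpa using hst
    have hzero := hR 1 0 (Or.inl one_ne_zero)
    simp only [zero_smul, add_zero] at hmax hzero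
    rw [← hmax, fieldRank_zero, Submodule.finrank_eq_zero, LinearMap.range_eq_bot] at hzero
    exact (le_top.trans_eq (by rw [hzero, LinearMap.ker_zero])).trans
      (ker_le_pencilCore _ _ (Or.inl one_ne_zero))

end CompleteStructures

section BilagrangianFoliation

open Module Filter Topology

variable {F : Type*} [NormedAddCommGroup F] [NormedSpace ℝ F]
  {N : Type*} [TopologicalSpace N] [ChartedSpace F N]

lemma differential_add {f g : N → ℝ} {x : N} (hf : MDifferentiableAt 𝓘(ℝ, F) 𝓘(ℝ, ℝ) f x)
    (hg : MDifferentiableAt 𝓘(ℝ, F) 𝓘(ℝ, ℝ) g x) :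
    differential (F := F) (f + g) x = differential f x + differential g x :=
  congrArg (fun L : F →L[ℝ] ℝ => L.toLinearMap) (mfderiv_add hf hg)

lemma differential_const_smul {f : N → ℝ} {x : N} (r : ℝ)
    (hf : MDifferentiableAt 𝓘(ℝ, F) 𝓘(ℝ, ℝ) f x) :
    differential (F := F) (r • f) x = r • differential f x :=
  congrArg (fun L : F →L[ℝ] ℝ => L.toLinearMap) (const_smul_mfderiv hf r)

lemma differential_zero (x : N) : differential (F := F) (0 : N → ℝ) x = 0 :=
  congrArg (fun L : F →L[ℝ] ℝ => L.toLinearMap) (mfderiv_const (c := (0 : ℝ)))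

variable {J : Submodule ℝ (TensorField F N)} {c₁ c₂ : TensorField F N} {x : N}

lemma differential_mem_of_mem_firstIntegrals {S : Submodule ℝ (Dual ℝ F)}
    (hS : ∀ c ∈ J, fieldRank c = maxRank J → LinearMap.ker (c x) ≤ S) {U : Set N}
    (hU : U ∈ 𝓝 x) {f : N → ℝ} (hf : f ∈ firstIntegrals J U) : differential f x ∈ S := by
  suffices h : MDifferentiableAt 𝓘(ℝ, F) 𝓘(ℝ, ℝ) f x ∧ differential f x ∈ S from h.2
  induction hf using Submodule.span_induction with
  | mem f hf =>
    obtain ⟨c, hc, hmax, hsmooth, hcasimir⟩ := hf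
    have hx := mem_of_mem_nhds hU
    exact ⟨((hsmooth x hx).contMDiffAt hU).mdifferentiableAt (by simp),
      hS c hc hmax (hcasimir x hx)⟩
  | zero => exact ⟨mdifferentiableAt_const, by rw [differential_zero]; exact S.zero_mem⟩
  | add f g _ _ hf hg =>
    refine ⟨hf.1.add hg.1, ?_⟩
    rw [differential_add hf.1 hg.1]
    exact S.add_mem hf.2 hg.2
  | smul r f _ hf =>
    refine ⟨hf.1.const_smul r, ?_⟩
    rw [differential_const_smul r hf.1]
    exact S.smul_mem r hf.2

variable [FiniteDimensional ℝ F]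

lemma dualAnnihilator_bilagrangianTangent_le {S : Submodule ℝ (Dual ℝ F)}
    (hS : ∀ c ∈ J, fieldRank c = maxRank J → LinearMap.ker (c x) ≤ S) :
    (bilagrangianTangent J x).dualAnnihilator ≤ S := by
  have hle : S.dualCoannihilator ≤ bilagrangianTangent J x := fun v hv U hU hx f hf =>
    (Submodule.mem_dualCoannihilator v).1 hv _
      (differential_mem_of_mem_firstIntegrals hS (hU.mem_nhds hx) hf)
  exact (Submodule.dualAnnihilator_anti hle).trans Subspace.dualCoannihilator_dualAnnihilator_eq.le

lemma ker_le_dualAnnihilator_bilagrangianTangent [IsManifold 𝓘(ℝ, F) ∞ N] {c : TensorField F N}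
    (hc : c ∈ J) (hpoisson : IsPoisson c) (hmax : ∀ᶠ q in 𝓝 x, formRank (c q) = maxRank J) :
    LinearMap.ker (c x) ≤ (bilagrangianTangent J x).dualAnnihilator := by
  intro ξ hξ
  have hfield : fieldRank c = maxRank J :=
    (fieldRank_le_maxRank hc).antisymm (hmax.self_of_nhds ▸ formRank_le_fieldRank c x)
  have hrank : ∀ᶠ q in 𝓝 x, formRank (c q) = formRank (c x) := by rwa [hmax.self_of_nhds]
  obtain ⟨U, hU, hxU, f, hf, rfl⟩ := exists_casimir hpoisson hrank hξ
  exact (Submodule.mem_dualAnnihilator _).2 fun v hv =>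
    hv U hU hxU f (Submodule.subset_span ⟨c, hc, hfield, hf⟩)

lemma baseChange_dualAnnihilator_bilagrangianTangent_le_pencilCore
    (hspan : J = Submodule.span ℝ {c₁, c₂})
    (hR : HasConstantRank ((c₁ x).baseChange ℂ) ((c₂ x).baseChange ℂ) (maxRank J)) :
    (bilagrangianTangent J x).dualAnnihilator.baseChange ℂ ≤
      pencilCore ((c₁ x).baseChange ℂ) ((c₂ x).baseChange ℂ) := by
  let S : Submodule ℝ (Dual ℝ F) :=
    ((pencilCore ((c₁ x).baseChange ℂ) ((c₂ x).baseChange ℂ)).restrictScalars ℝ).comap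
      (TensorProduct.mk ℝ ℂ (Dual ℝ F) 1)
  have hle : (bilagrangianTangent J x).dualAnnihilator ≤ S :=
    dualAnnihilator_bilagrangianTangent_le fun c hc hmax ξ hξ =>
      baseChange_ker_le_pencilCore hR (hspan ▸ hc) hmax
        (Submodule.tmul_mem_baseChange_of_mem 1 hξ)
  rw [Submodule.baseChange_eq_span, Submodule.span_le]
  rintro _ ⟨ξ, hξ, rfl⟩
  exact hle hξ

lemma pencilCore_le_baseChange_dualAnnihilator_bilagrangianTangent [IsManifold 𝓘(ℝ, F) ∞ N]
    (hJ : IsBihamiltonian J) (hspan : J = Submodule.span ℝ {c₁, c₂}) (hx : x ∈ completeLocus J) :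
    pencilCore ((c₁ x).baseChange ℂ) ((c₂ x).baseChange ℂ) ≤
      (bilagrangianTangent J x).dualAnnihilator.baseChange ℂ := by
  have hcomplete : ∀ᶠ q in 𝓝 x, CompleteAt J q := mem_interior_iff_mem_nhds.1 hx
  refine (hcomplete.self_of_nhds.hasConstantRank hJ hspan).pencilCore_le_iSup
    (Set.infinite_range_of_injective Complex.ofReal_injective) |>.trans (iSup₂_le ?_)
  rintro _ ⟨r, rfl⟩
  have hc : c₁ + r • c₂ ∈ J := by
    rw [hspan]
    exact Submodule.mem_span_pair.2 ⟨1, r, by rw [one_smul]⟩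
  have hbaseChange (q : N) : (c₁ q).baseChange ℂ + (r : ℂ) • (c₂ q).baseChange ℂ =
      ((c₁ + r • c₂) q).baseChange ℂ := by
    simpa using (bilinForm_baseChange_smul_add_smul ℂ 1 r (c₁ q) (c₂ q)).symm
  rw [hbaseChange, ker_bilinForm_baseChange]
  refine Submodule.baseChange_mono ℂ
    (ker_le_dualAnnihilator_bilagrangianTangent hc (hJ.poisson _ hc) ?_)
  filter_upwards [hcomplete] with q hq
  rw [← formRank_baseChange ℂ, ← hbaseChange]
  exact (hq.hasConstantRank hJ hspan).finrank_range_add_smul r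

theorem orthogonal_baseChange_dualAnnihilator_bilagrangianTangent [IsManifold 𝓘(ℝ, F) ∞ N]
    (hJ : IsBihamiltonian J) (hspan : J = Submodule.span ℝ {c₁, c₂}) (hx : x ∈ completeLocus J) :
    (complexValue c₁ c₂ x).orthogonal ((bilagrangianTangent J x).dualAnnihilator.baseChange ℂ) =
      (bilagrangianTangent J x).dualAnnihilator.baseChange ℂ := by
  have hrank := (interior_subset hx : CompleteAt J x).hasConstantRank hJ hspan
  have hcore : (bilagrangianTangent J x).dualAnnihilator.baseChange ℂ =
      pencilCore ((c₁ x).baseChange ℂ) ((c₂ x).baseChange ℂ) :=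
    (baseChange_dualAnnihilator_bilagrangianTangent_le_pencilCore hspan hrank).antisymm
      (pencilCore_le_baseChange_dualAnnihilator_bilagrangianTangent hJ hspan hx)
  have halt {c : TensorField F N} (hc : c ∈ J) : ((c x).baseChange ℂ).IsAlt :=
    isAlt_baseChange ℂ ((hJ.poisson c hc).alternating x)
  have horthogonal := hrank.orthogonal_pencilCore
    (halt (hspan ▸ Submodule.subset_span (by simp)))
    (halt (hspan ▸ Submodule.subset_span (by simp)))
    (x := 1) (y := Complex.I) (Or.inl one_ne_zero)
  rwa [one_smul, ← hcore] at horthogonal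

end BilagrangianFoliation

section RankSemicontinuity

open Module TensorProduct

variable {F : Type*} [NormedAddCommGroup F] [NormedSpace ℝ F]
  {N : Type*} [TopologicalSpace N] [ChartedSpace F N] [IsManifold 𝓘(ℝ, F) ∞ N]
  {c₁ c₂ : TensorField F N}

lemma formRank_complexValue_chartTensor (c₁ c₂ : TensorField F N) {x q : N}
    (hq : q ∈ (chartAt F x).source) :
    formRank (complexValue (chartTensor c₁ x) (chartTensor c₂ x) (chartAt F x q)) =
      formRank (complexValue c₁ c₂ q) := by
  let g := (chartDifferential F x q).toLinearMap.dualMap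
  have hcompl : complexValue (chartTensor c₁ x) (chartTensor c₂ x) (chartAt F x q) =
      (complexValue c₁ c₂ q).compl₁₂ (g.baseChange ℂ) (g.baseChange ℂ) := by
    refine bilinForm_baseChange_ext fun α β => ?_
    rw [complexValue_one_tmul, chartTensor_chartAt c₁ hq, chartTensor_chartAt c₂ hq]
    exact (complexValue_one_tmul c₁ c₂ q (g α) (g β)).symm
  rw [hcompl, formRank_compl₁₂ _ (LinearMap.baseChange_surjective ℂ
    (dualMap_chartDifferential_surjective hq))]

variable [FiniteDimensional ℝ F]

lemma continuousOn_complexValue_chartTensor (h₁ : IsPoisson c₁) (h₂ : IsPoisson c₂) (x : N)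
    (u v : ℂ ⊗[ℝ] Dual ℝ F) :
    ContinuousOn (fun z => complexValue (chartTensor c₁ x) (chartTensor c₂ x) z u v)
      (chartAt F x).target := by
  refine continuousOn_bilinForm_baseChange (fun α β => ?_) u v
  simp only [complexValue_one_tmul]
  have hcont {c : TensorField F N} (hc : IsPoisson c) :
      ContinuousOn (fun z => (chartTensor c x z α β : ℂ)) (chartAt F x).target :=
    Complex.continuous_ofReal.comp_continuousOn (contDiffOn_chartTensor hc x α β).continuousOn
  exact (hcont h₁).add (continuousOn_const.mul (hcont h₂))

lemma lowerSemicontinuous_formRank_complexValue (h₁ : IsPoisson c₁) (h₂ : IsPoisson c₂) :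
    LowerSemicontinuous fun q => formRank (complexValue c₁ c₂ q) := by
  intro x R hR
  have hx := mem_chart_source F x
  have hchart : LowerSemicontinuousOn (fun q =>
      formRank (complexValue (chartTensor c₁ x) (chartTensor c₂ x) (chartAt F x q)))
      (chartAt F x).source :=
    (lowerSemicontinuousOn_formRank (continuousOn_complexValue_chartTensor h₁ h₂ x)).comp
      (chartAt F x).continuousOn (chartAt F x).mapsTo
  have hsource := (chartAt F x).open_source.mem_nhds hx
  have hRx : R < formRank (complexValue (chartTensor c₁ x) (chartTensor c₂ x) (chartAt F x x)) := by
    rwa [formRank_complexValue_chartTensor c₁ c₂ hx]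
  have hevent := hchart x hx R hRx
  rw [nhdsWithin_eq_nhds.2 hsource] at hevent
  filter_upwards [hevent, hsource] with q hq hqx
  rwa [← formRank_complexValue_chartTensor c₁ c₂ hqx]

end RankSemicontinuity

/-! ### Realizations -/

section Realization

open Module

lemma IsCompleteBihamiltonian.dense_completeLocus {F : Type*} [NormedAddCommGroup F]
    [NormedSpace ℝ F] {N : Type*} [TopologicalSpace N] [ChartedSpace F N]
    {J : Submodule ℝ (TensorField F N)} (hJ : IsCompleteBihamiltonian J) :
    Dense (completeLocus J) := by
  obtain ⟨U, hU, hdense, hcomplete⟩ := hJ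
  exact hdense.mono (interior_maximal hcomplete hU)

lemma crSubspace_le_orthogonal_mono {E : Type*} [NormedAddCommGroup E] [NormedSpace ℂ E]
    {B : LinearMap.BilinForm ℂ E} {D D' : Submodule ℝ E} (hD : D ≤ D')
    (h : crSubspace D' ≤ B.orthogonal (crSubspace D')) :
    crSubspace D ≤ B.orthogonal (crSubspace D) :=
  (crSubspace_mono hD).trans (h.trans (LinearMap.BilinForm.orthogonal_le (crSubspace_mono hD)))

variable {E : Type*} [NormedAddCommGroup E] [NormedSpace ℂ E] [FiniteDimensional ℂ E]
  {M : Type*} [TopologicalSpace M] [ChartedSpace E M]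
  {E' : Type*} [NormedAddCommGroup E'] [NormedSpace ℝ E']
  {M' : Type*} [TopologicalSpace M'] [ChartedSpace E' M']
  {Ω : HolomorphicSymplecticForm E M} {p : M → M'} {x : M}
  {c₁ c₂ : TensorField E' M'}

lemma orthogonal_crSubspace_pullbackTangent_eq (h₁ : IsPushforward p (reBivector Ω) c₁)
    (h₂ : IsPushforward p (imBivector Ω) c₂)
    (hisotropic : crSubspace (fibreTangent E E' p x) ≤
      (toBilin (Ω.toFun x)).orthogonal (crSubspace (fibreTangent E E' p x)))
    {D' : M' → Submodule ℝ E'}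
    (hD' : (complexValue c₁ c₂ (p x)).orthogonal ((D' (p x)).dualAnnihilator.baseChange ℂ) =
      (D' (p x)).dualAnnihilator.baseChange ℂ) :
    (toBilin (Ω.toFun x)).orthogonal (crSubspace (pullbackTangent p D' x)) =
      crSubspace (pullbackTangent p D' x) := by
  rw [← toBilin_complexHamiltonianLift_eq_complexValue h₁ h₂] at hD'
  have hlift := orthogonal_map_eq (Ω.nondegenerate x) (isAlt_toBilin _).isRefl
    ((crSubspace_ker_le_orthogonal_iff Ω x _).1 hisotropic) hD'
  rw [pullbackTangent, crSubspace_comap_eq_orthogonal Ω, hlift, hlift]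

variable [FiniteDimensional ℝ E'] [IsManifold 𝓘(ℝ, E') ∞ M']

lemma isCRIsotropicOn_univ_of_dense (hsurj : Function.Surjective p)
    (hsubmersion : ∀ x, Function.Surjective (realDifferential E E' p x))
    (hgeneric : ∀ x, fibreTangent E E' p x ⊔ (fibreTangent E E' p x).map (complexStructure E) = ⊤)
    (h₁ : IsPushforward p (reBivector Ω) c₁) (h₂ : IsPushforward p (imBivector Ω) c₂)
    (hc₁ : IsPoisson c₁) (hc₂ : IsPoisson c₂) {U : Set M'} (hU : Dense U)
    (hisotropic : IsCRIsotropicOn Ω (p ⁻¹' U) (fibreTangent E E' p)) :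
    IsCRIsotropicOn Ω Set.univ (fibreTangent E E' p) := by
  have hiff (x : M) := crSubspace_fibreTangent_le_orthogonal_iff_formRank_le (Ω := Ω)
    (hsubmersion x) (hgeneric x) h₁ h₂
  have hclosed : IsClosed
      {q | formRank (complexValue c₁ c₂ q) + finrank ℂ E ≤ 2 * finrank ℝ E'} :=
    ((lowerSemicontinuous_formRank_complexValue hc₁ hc₂).add
      lowerSemicontinuous_const).isClosed_preimage _
  have hrank (q : M') : formRank (complexValue c₁ c₂ q) + finrank ℂ E ≤ 2 * finrank ℝ E' := by
    refine hU.induction (fun q hq => ?_) hclosed q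
    obtain ⟨x, rfl⟩ := hsurj q
    exact (hiff x).1 (hisotropic x hq)
  exact fun x _ => (hiff x).2 (hrank (p x))

end Realization

end CRBihamiltonian

end

theorem mainTheorem10_general
    {E : Type*} [NormedAddCommGroup E] [NormedSpace ℂ E] [FiniteDimensional ℂ E]
    {M : Type*} [TopologicalSpace M] [ChartedSpace E M]
    {E' : Type*} [NormedAddCommGroup E'] [NormedSpace ℝ E'] [FiniteDimensional ℝ E']
    {M' : Type*} [TopologicalSpace M'] [ChartedSpace E' M'] [IsManifold 𝓘(ℝ, E') ∞ M']
    (Ω : HolomorphicSymplecticForm E M) (p : M → M')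
    (J' : Submodule ℝ (TensorField E' M'))
    (hJ' : IsBihamiltonian J') (hcomplete : IsCompleteBihamiltonian J')
    (_hp : MDifferentiable 𝓘(ℝ, E) 𝓘(ℝ, E') p) (hsurj : Function.Surjective p)
    (hsubmersion : ∀ x, Function.Surjective (realDifferential E E' p x))
    (hgeneric : ∀ x, fibreTangent E E' p x ⊔ (fibreTangent E E' p x).map (complexStructure E) = ⊤)
    {c₁ c₂ : TensorField E' M'} (h₁ : IsPushforward p (reBivector Ω) c₁)
    (h₂ : IsPushforward p (imBivector Ω) c₂) (hspan : J' = Submodule.span ℝ {c₁, c₂}) :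
    IsMinimal E' Ω p ↔
      IsCRLagrangianOn Ω (p ⁻¹' completeLocus J')
        (pullbackTangent p (bilagrangianTangent J')) := by
  have hc₁ : IsPoisson c₁ := hJ'.poisson c₁ (hspan ▸ Submodule.subset_span (by simp))
  have hc₂ : IsPoisson c₂ := hJ'.poisson c₂ (hspan ▸ Submodule.subset_span (by simp))
  constructor
  · intro hminimal x hx
    exact orthogonal_crSubspace_pullbackTangent_eq h₁ h₂ (hminimal x (Set.mem_univ x))
      (orthogonal_baseChange_dualAnnihilator_bilagrangianTangent hJ' hspan hx)
  · intro hlagrangian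
    refine isCRIsotropicOn_univ_of_dense hsurj hsubmersion hgeneric h₁ h₂ hc₁ hc₂
      hcomplete.dense_completeLocus fun x hx => ?_
    exact crSubspace_le_orthogonal_mono (Submodule.comap_mono bot_le) (hlagrangian x hx).ge

theorem mainTheorem10
    {E : Type*} [NormedAddCommGroup E] [NormedSpace ℂ E] [FiniteDimensional ℂ E]
    {M : Type*} [TopologicalSpace M] [ChartedSpace E M] [IsManifold 𝓘(ℂ, E) ω M]
    {E' : Type*} [NormedAddCommGroup E'] [NormedSpace ℝ E'] [FiniteDimensional ℝ E']
    {M' : Type*} [TopologicalSpace M'] [ChartedSpace E' M'] [IsManifold 𝓘(ℝ, E') ∞ M']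
    (Ω : HolomorphicSymplecticForm E M) (p : M → M')
    (J' : Submodule ℝ (TensorField E' M'))
    (hJ' : IsBihamiltonian J') (hcomplete : IsCompleteBihamiltonian J')
    (hrealization : IsRealization Ω p J')
    (hgeneric : IsGenericCRFibration E E' p) :
    IsMinimal E' Ω p ↔
      IsCRLagrangianOn Ω (p ⁻¹' completeLocus J')
        (pullbackTangent p (bilagrangianTangent J')) := by
  obtain ⟨hfibration, c₁, c₂, h₁, h₂, hspan⟩ := hrealization
  exact mainTheorem10_general Ω p J' hJ' hcomplete (hfibration.smooth.mdifferentiable (by simp))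
    (fun x' => (hfibration.connected x').nonempty) hfibration.submersion hgeneric.generic
    h₁ h₂ hspan
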